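/- Let $\mathcal Q$ be an arbitrary class of finite simple graphs. Then at least one of the following holds. (1) There is a polynomial-time algorithm that solves 3-colorability on every graph in $\mathcal Q$: given (the adjacency matrix of) a graph in $\mathcal Q$, it decides whether the graph is 3-colorable and, if it is, outputs a proper 3-coloring, in a number of steps that is polynomial in the number of vertices. (2) $\mathcal Q$ contains a graph $Q$ that is unlikely to appear as a subgraph of a sparse random graph: for every $n\ge 1$ and every $0\le p\le n^{-2/3}$, the probability that $G_{n,p}$ contains a (not necessarily induced) copy of $Q$ is at most $n^{-1/3}$. More precisely, call $\mathcal Q$ *3-sparse* if no subgraph of a graph in $\mathcal Q$ has average degree above $3$ (every graph counts as a subgraph of itself). If $\mathcal Q$ is 3-sparse, then (1) holds; if $\mathcal Q$ is not 3-sparse, then (2) holds. -/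

import Mathlib

namespace SparseColoring

/-! ### Graphs and sparsity -/

/-- A finite graph, presented on the vertex set `{0, …, n - 1}`.  A class of graphs is a
`Set FinGraph`; it need not be closed under isomorphism. -/
abbrev FinGraph : Type := Σ n : ℕ, SimpleGraph (Fin n)

/-- The average degree `2|E| / |V|` of a subgraph (`0` for the subgraph without vertices). -/
noncomputable def avgDegree {V : Type*} {G : SimpleGraph V} (H : G.Subgraph) : ℝ :=
  2 * (H.edgeSet.ncard : ℝ) / (H.verts.ncard : ℝ)

/-- A class of graphs is 3-sparse if no subgraph of a member has average degree above `3`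
(each member is a subgraph of itself). -/
def ThreeSparse (C : Set FinGraph) : Prop :=
  ∀ Q ∈ C, ∀ H : Q.2.Subgraph, avgDegree H ≤ 3

/-! ### Random graphs -/

/-- `Q` is unlikely to appear as a (not necessarily induced) subgraph of a random graph
`G(n, p)` with `p ≤ n ^ (-2/3)`: the probability is at most `n ^ (-1/3)`, for every `n ≥ 1`.
Here `SimpleGraph.binomialRandom (Fin n) p` is the law of `G(n, p)`. -/
def UnlikelySubgraph (Q : FinGraph) : Prop :=
  ∀ n : ℕ, 1 ≤ n → ∀ p : unitInterval, (p : ℝ) ≤ (n : ℝ) ^ (-(2 / 3) : ℝ) →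
    (SimpleGraph.binomialRandom (Fin n) p).real
        {G : SimpleGraph (Fin n) | SimpleGraph.IsContained Q.2 G} ≤
      (n : ℝ) ^ (-(1 / 3) : ℝ)

/-! ### Machine model

A random access machine with natural-number variables and arrays, programmed in a structured
language, at unit cost per operation.  The arithmetic operations are addition and truncated
subtraction only, so that a computation of `t` steps creates only numbers with `O(t)` more bits than
the largest input number; hence polynomial time on this machine is polynomial time in the usual
sense. -/

/-- A memory: variables `x₀, x₁, …` and two-dimensional arrays `A₀, A₁, …`.  A program mentions
only finitely many variables and arrays by name; array indices are computed. -/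
structure Memory where
  /-- The value of a variable. -/
  var : ℕ → ℕ
  /-- `arr a i j` is the entry `A_a[i, j]`. -/
  arr : ℕ → ℕ → ℕ → ℕ

/-- Expressions. -/
inductive Expr : Type
  /-- a constant -/
  | const (c : ℕ) : Expr
  /-- the variable `x` -/
  | var (x : ℕ) : Expr
  /-- the entry `A_a[i, j]` -/
  | get (a : ℕ) (i j : Expr) : Expr
  /-- addition -/
  | add (e₁ e₂ : Expr) : Expr
  /-- truncated subtraction -/
  | sub (e₁ e₂ : Expr) : Expr

/-- The value of an expression. -/
def Expr.eval (s : Memory) : Expr → ℕ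
  | .const c => c
  | .var x => s.var x
  | .get a i j => s.arr a (i.eval s) (j.eval s)
  | .add e₁ e₂ => e₁.eval s + e₂.eval s
  | .sub e₁ e₂ => e₁.eval s - e₂.eval s

/-- The number of operations needed to evaluate an expression. -/
def Expr.cost : Expr → ℕ
  | .const _ => 1
  | .var _ => 1
  | .get _ i j => i.cost + j.cost + 1
  | .add e₁ e₂ => e₁.cost + e₂.cost + 1
  | .sub e₁ e₂ => e₁.cost + e₂.cost + 1

/-- The memory after `x := v`. -/
def Memory.setVar (s : Memory) (x v : ℕ) : Memory :=
  { s with var := fun y => if y = x then v else s.var y }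

/-- The memory after `A_a[i, j] := v`. -/
def Memory.setArr (s : Memory) (a i j v : ℕ) : Memory :=
  { s with arr := fun a' i' j' => if a' = a ∧ i' = i ∧ j' = j then v else s.arr a' i' j' }

/-- Programs. -/
inductive Prog : Type
  /-- do nothing -/
  | skip : Prog
  /-- `x := e` -/
  | assign (x : ℕ) (e : Expr) : Prog
  /-- `A_a[i, j] := e` -/
  | store (a : ℕ) (i j e : Expr) : Prog
  /-- first `c₁`, then `c₂` -/
  | seq (c₁ c₂ : Prog) : Prog
  /-- if `e ≠ 0` then `c₁` else `c₂` -/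
  | ite (e : Expr) (c₁ c₂ : Prog) : Prog
  /-- while `e ≠ 0` do `c` -/
  | loop (e : Expr) (c : Prog) : Prog

/-- `Run c s t s'`: started on memory `s`, the program `c` halts after exactly `t` steps with
memory `s'`. -/
inductive Run : Prog → Memory → ℕ → Memory → Prop
  | skip (s : Memory) : Run .skip s 1 s
  | assign (x : ℕ) (e : Expr) (s : Memory) :
      Run (.assign x e) s (e.cost + 1) (s.setVar x (e.eval s))
  | store (a : ℕ) (i j e : Expr) (s : Memory) :
      Run (.store a i j e) s (i.cost + j.cost + e.cost + 1)
        (s.setArr a (i.eval s) (j.eval s) (e.eval s))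
  | seq {c₁ c₂ : Prog} {s s' s'' : Memory} {t₁ t₂ : ℕ} :
      Run c₁ s t₁ s' → Run c₂ s' t₂ s'' → Run (.seq c₁ c₂) s (t₁ + t₂) s''
  | ite_true {e : Expr} {c₁ c₂ : Prog} {s s' : Memory} {t : ℕ} :
      e.eval s ≠ 0 → Run c₁ s t s' → Run (.ite e c₁ c₂) s (e.cost + 1 + t) s'
  | ite_false {e : Expr} {c₁ c₂ : Prog} {s s' : Memory} {t : ℕ} :
      e.eval s = 0 → Run c₂ s t s' → Run (.ite e c₁ c₂) s (e.cost + 1 + t) s'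
  | loop_done {e : Expr} {c : Prog} {s : Memory} :
      e.eval s = 0 → Run (.loop e c) s (e.cost + 1) s
  | loop_step {e : Expr} {c : Prog} {s s' s'' : Memory} {t₁ t₂ : ℕ} :
      e.eval s ≠ 0 → Run c s t₁ s' → Run (.loop e c) s' t₂ s'' →
        Run (.loop e c) s (e.cost + 1 + t₁ + t₂) s''

/-! ### Solving 3-colorability in polynomial time -/

open scoped Classical in
/-- The input memory: `x₀` is the number of vertices, `A₀` is the adjacency matrix, and
everything else is `0`. -/
noncomputable def inputMemory (Q : FinGraph) : Memory where
  var x := if x = 0 then Q.1 else 0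
  arr a i j :=
    if a = 0 ∧ ∃ (hi : i < Q.1) (hj : j < Q.1), Q.2.Adj ⟨i, hi⟩ ⟨j, hj⟩ then 1 else 0

/-- The memory `s` holds a correct answer for `Q`: either `Q` is 3-colorable, `x₀ = 1`, and
`A₁[0, 0], …, A₁[n - 1, 0]` is a proper coloring with colors `0, 1, 2`; or `Q` is not
3-colorable and `x₀ = 0`. -/
def CorrectAnswer (Q : FinGraph) (s : Memory) : Prop :=
  (Q.2.Colorable 3 ∧ s.var 0 = 1 ∧
      ∃ f : Q.2.Coloring (Fin 3), ∀ v : Fin Q.1, s.arr 1 v 0 = (f v : ℕ)) ∨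
    (¬ Q.2.Colorable 3 ∧ s.var 0 = 0)

/-- There is a polynomial time algorithm for solving 3-colorability on every graph of the class:
a single program that, within polynomially many steps in the number of vertices, decides whether
the input graph is 3-colorable and, if so, outputs a proper 3-coloring. -/
def PolyTimeThreeColoring (C : Set FinGraph) : Prop :=
  ∃ (c : Prog) (P : Polynomial ℕ), ∀ Q ∈ C, ∃ (t : ℕ) (s : Memory),
    Run c (inputMemory Q) t s ∧ t ≤ P.eval Q.1 ∧ CorrectAnswer Q s

end SparseColoring

/-! ### Random graphs: the union bound for dense subgraphs -/

namespace SparseColoring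

open MeasureTheory ProbabilityTheory unitInterval

/-! Dense case. If a subgraph `H` of `Q` with v vertices and e edges has average degree above 3,
then 2e ≥ 3v + 1 by integrality. There are at most n^v placements of `H`, each present with
probability at most p^e, so for p ≤ n^(-2/3) the union bound gives n^(v - 2e/3) ≤ n^(-1/3)
(`unlikelySubgraph_of_avgDegree`).

Sparse case. Call a graph nice if it has no K₄ and all its induced subgraphs of minimum degree at
least 3 are cubic. A K₄ rules out a 3-coloring, and by the handshake lemma a 3-sparse graph without
K₄ is nice. So it suffices to recognise nice graphs and to 3-color them. The key fact is
`exists_glue`: a nice graph on at least four vertices has two nonadjacent vertices whose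
identification leaves it nice. Vertices of degree at most 2 do not matter for niceness; once they
are set aside, a cubic graph or a four-vertex base case remains. In a cubic graph, identify two
nonadjacent neighbours a, b of a vertex v. Then v drops to degree 2, and a set violating niceness
through a merged vertex of degree 4 forces va and vb to be the only edges leaving some vertex set.
Descending to smaller such sets yields a triple v, a, b without one (`exists_uncut`). A diamond (K₄
minus an edge) is treated separately by identifying its two nonadjacent vertices; without diamonds
the identification creates no K₄.

Hence greedy merging of classes, as long as the quotient stays nice, never gets stuck above three
classes (`IsNicePartition.card_le_three`) and needs no backtracking. Niceness is tested by peeling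
off vertices of degree at most 2: only the largest set of minimum degree at least 3 has to be
examined (`isNice_iff`). The program uses only for-loops of length n, so a polynomial bound can be
read off its syntax (`run_compile`). -/

/-- The event is a cylinder of the product measure. Elements outside `u` are almost surely absent,
hence the condition on `E`. -/
lemma setBernoulli_superset_eq {ι : Type*} (u : Set ι) (p : I) (E : Finset ι)
    (hE : (E : Set ι) ⊆ u) :
    setBernoulli u p {s | (E : Set ι) ⊆ s} = (toNNReal p : ENNReal) ^ E.card := by
  rw [setBernoulli_apply']
  have : ((fun q : ι → Prop ↦ {i | q i}) ⁻¹' {s | (E : Set ι) ⊆ s}) =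
      Set.pi (E : Set ι) (fun _ => {True}) := by
    ext q
    simp [Set.subset_def, Set.mem_pi]
  rw [this, Measure.infinitePi_pi _ (by simp)]
  rw [Finset.prod_congr rfl (g := fun _ => (toNNReal p : ENNReal)), Finset.prod_const]
  intro i hi
  have := hE hi
  simp [this]

lemma binomialRandom_subset_edgeSet_le {V : Type*} [Countable V] (p : I) (E : Finset (Sym2 V))
    (hE : ∀ e ∈ E, ¬ e.IsDiag) :
    SimpleGraph.binomialRandom V p {G | (E : Set (Sym2 V)) ⊆ G.edgeSet} ≤
      (toNNReal p : ENNReal) ^ E.card := by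
  rw [SimpleGraph.binomialRandom_apply', ← setBernoulli_superset_eq Sym2.diagSetᶜ p E]
  · refine measure_mono ?_
    rintro _ ⟨G, hG, rfl⟩
    exact hG
  · intro e he
    simpa using hE e he

/-- The union bound over all placements of a subgraph. -/
lemma binomialRandom_isContained_le {V : Type*} [Fintype V] (Q : SimpleGraph V) (H : Q.Subgraph)
    (n : ℕ) (p : I) :
    (SimpleGraph.binomialRandom (Fin n) p).real {G | SimpleGraph.IsContained Q G} ≤
      (n : ℝ) ^ H.verts.ncard * (p : ℝ) ^ H.edgeSet.ncard := by
  classical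
  -- The placements of `H`: a copy of `Q` in `G` restricts to an injection of the vertices of `H`
  -- that maps its edges to edges of `G`.
  let J := {g : H.verts → Fin n // Function.Injective g}
  let E : J → Finset (Sym2 (Fin n)) := fun g => H.coe.edgeFinset.image (Sym2.map g.1)
  have hsub : {G : SimpleGraph (Fin n) | SimpleGraph.IsContained Q G} ⊆
      ⋃ g : J, {G | (E g : Set (Sym2 (Fin n))) ⊆ G.edgeSet} := by
    rintro G ⟨f⟩
    have f' := f.comp H.coeCopy
    simp only [Set.mem_iUnion]
    refine ⟨⟨f', f'.injective⟩, ?_⟩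
    intro e he
    simp only [E, Finset.coe_image, Set.mem_image] at he
    obtain ⟨e, he, rfl⟩ := he
    induction e with | _ x y
    simp only [SimpleGraph.coe_edgeFinset, SimpleGraph.mem_edgeSet] at he
    simpa using f'.toHom.map_adj he
  have hcard : ∀ g : J, (E g).card = H.edgeSet.ncard := by
    intro g
    rw [Finset.card_image_of_injective _ (Sym2.map.injective g.2), ← Set.ncard_coe_finset,
      SimpleGraph.coe_edgeFinset,
      ← Set.ncard_image_of_injective _ (Sym2.map.injective Subtype.val_injective)]
    congr 1
    exact H.image_coe_edgeSet_coe
  have hJ : Fintype.card J ≤ n ^ H.verts.ncard := by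
    calc Fintype.card J ≤ Fintype.card (H.verts → Fin n) := Fintype.card_subtype_le _
      _ = n ^ H.verts.ncard := by
        rw [Fintype.card_fun, Fintype.card_fin, ← Nat.card_eq_fintype_card, Nat.card_coe_set_eq]
  have hle : SimpleGraph.binomialRandom (Fin n) p {G | SimpleGraph.IsContained Q G} ≤
      (n : ENNReal) ^ H.verts.ncard * (toNNReal p : ENNReal) ^ H.edgeSet.ncard := by
    calc _ ≤ _ := measure_mono hsub
      _ ≤ ∑ g : J, _ := measure_iUnion_fintype_le _ _
      _ ≤ ∑ _g : J, (toNNReal p : ENNReal) ^ H.edgeSet.ncard := by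
        refine Finset.sum_le_sum fun g _ => ?_
        rw [← hcard g]
        refine binomialRandom_subset_edgeSet_le p (E g) ?_
        intro e he
        simp only [E, Finset.mem_image] at he
        obtain ⟨e, he, rfl⟩ := he
        induction e with | _ x y
        simp only [SimpleGraph.mem_edgeFinset, SimpleGraph.mem_edgeSet] at he
        simpa using fun h => he.ne (g.2 h)
      _ ≤ _ := by
        simp only [Finset.sum_const, nsmul_eq_mul, Finset.card_univ]
        gcongr
        exact_mod_cast hJ
  have := ENNReal.toReal_mono (by finiteness) hle
  simpa [Measure.real] using this

lemma unlikelySubgraph_of_avgDegree {Q : FinGraph} (H : Q.2.Subgraph) (h : 3 < avgDegree H) :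
    UnlikelySubgraph Q := by
  intro n hn p hp
  refine (binomialRandom_isContained_le Q.2 H n p).trans ?_
  -- Without vertices the average degree is `0` by the convention for division by zero.
  have hv : 0 < H.verts.ncard := by
    by_contra h0
    have : H.verts.ncard = 0 := by omega
    simp [avgDegree, this] at h
    norm_num at h
  -- The strict inequality between integers gains `1`; this is the source of the exponent `-1/3`.
  have he : 3 * H.verts.ncard + 1 ≤ 2 * H.edgeSet.ncard := by
    rw [avgDegree, lt_div_iff₀ (by positivity)] at h
    exact_mod_cast h
  have hn' : (1 : ℝ) ≤ n := by exact_mod_cast hn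
  have he' : (3 * H.verts.ncard + 1 : ℝ) ≤ 2 * H.edgeSet.ncard := by exact_mod_cast he
  calc (n : ℝ) ^ H.verts.ncard * (p : ℝ) ^ H.edgeSet.ncard
      ≤ (n : ℝ) ^ H.verts.ncard * ((n : ℝ) ^ (-(2 / 3) : ℝ)) ^ H.edgeSet.ncard := by
        gcongr
        exact p.2.1
    _ = (n : ℝ) ^ ((H.verts.ncard : ℝ) + -(2 / 3) * H.edgeSet.ncard) := by
        rw [Real.rpow_add (by linarith), Real.rpow_mul (by linarith), Real.rpow_natCast,
          Real.rpow_natCast]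
    _ ≤ (n : ℝ) ^ (-(1 / 3) : ℝ) := by
        apply Real.rpow_le_rpow_of_exponent_le hn'
        linarith

end SparseColoring

/-! ### Nice graphs and the identification of two vertices -/

namespace SparseColoring

open scoped Classical in
/-- The number of neighbours of `v` in `S`. -/
noncomputable def degIn {V : Type*} (H : SimpleGraph V) (S : Finset V) (v : V) : ℕ :=
  (S.filter (H.Adj v)).card

/-- Inside `U` the graph has no `K₄`, and its subgraphs of minimum degree at least `3` are
`3`-regular. -/
structure NiceOn {V : Type*} (H : SimpleGraph V) (U : Finset V) : Prop where
  noK4 : ∀ a ∈ U, ∀ b ∈ U, ∀ c ∈ U, ∀ d ∈ U, H.Adj a b → H.Adj a c → H.Adj a d →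
    H.Adj b c → H.Adj b d → H.Adj c d → False
  cubic : ∀ S ⊆ U, (∀ v ∈ S, 3 ≤ degIn H S v) → ∀ v ∈ S, degIn H S v ≤ 3

/-- The image of a graph under a map of its vertices, without loops. -/
def quotGraph {V W : Type*} (G : SimpleGraph V) (f : V → W) : SimpleGraph W where
  Adj i j := i ≠ j ∧ ∃ x y, G.Adj x y ∧ f x = i ∧ f y = j
  symm := ⟨by
    rintro i j ⟨h, x, y, hxy, hx, hy⟩
    exact ⟨h.symm, y, x, hxy.symm, hy, hx⟩⟩
  loopless := ⟨fun _ h => h.1 rfl⟩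

/-- The map that identifies `b` with `a`. -/
def glue {V : Type*} [DecidableEq V] (a b x : V) : V := if x = b then a else x

variable {V : Type*}

lemma NiceOn.mono {H : SimpleGraph V} {U W : Finset V} (h : NiceOn H U) (hW : W ⊆ U) :
    NiceOn H W where
  noK4 a ha b hb c hc d hd := h.noK4 a (hW ha) b (hW hb) c (hW hc) d (hW hd)
  cubic S hS := h.cubic S (hS.trans hW)

lemma degIn_mono (H : SimpleGraph V) {S T : Finset V} (h : S ⊆ T) (v : V) :
    degIn H S v ≤ degIn H T v := by
  classical
  exact Finset.card_le_card (Finset.filter_subset_filter _ h)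

lemma quotGraph_comp {W X : Type*} (G : SimpleGraph V) (f : V → W) (g : W → X)
    (hf : ∀ x y, G.Adj x y → f x ≠ f y) :
    quotGraph G (g ∘ f) = quotGraph (quotGraph G f) g := by
  ext i j
  constructor
  · rintro ⟨h, x, y, hxy, hx, hy⟩
    exact ⟨h, f x, f y, ⟨hf x y hxy, x, y, hxy, rfl, rfl⟩, hx, hy⟩
  · rintro ⟨h, _, _, ⟨-, x, y, hxy, rfl, rfl⟩, hx, hy⟩
    exact ⟨h, x, y, hxy, hx, hy⟩

/-- A vertex of degree at most `2` lies in no K₄ and in no set of minimum degree `3`, so it cannot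
affect niceness. -/
lemma NiceOn.insert_of_degIn {H : SimpleGraph V} [DecidableEq V] {U : Finset V} {u : V}
    (h : NiceOn H (U.erase u)) (hu : degIn H U u ≤ 2) : NiceOn H U := by
  classical
  have key : ∀ S ⊆ U, 3 ≤ degIn H S u → False := fun S hS h3 => by
    have := degIn_mono H hS u
    omega
  have clique : ∀ b ∈ U, ∀ c ∈ U, ∀ d ∈ U, H.Adj u b → H.Adj u c → H.Adj u d →
      H.Adj b c → H.Adj b d → H.Adj c d → False := by
    intro b hb c hc d hd hub huc hud hbc hbd hcd
    refine key {b, c, d} (by grind) ?_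
    rw [degIn, Finset.filter_true_of_mem (by grind)]
    rw [Finset.card_eq_three.2 ⟨b, c, d, hbc.ne, hbd.ne, hcd.ne, rfl⟩]
  refine ⟨?_, ?_⟩
  · intro a ha b hb c hc d hd hab hac had hbc hbd hcd
    by_cases h1 : a = u
    · subst h1; exact clique b hb c hc d hd hab hac had hbc hbd hcd
    by_cases h2 : b = u
    · subst h2; exact clique a ha c hc d hd hab.symm hbc hbd hac had hcd
    by_cases h3 : c = u
    · subst h3; exact clique a ha b hb d hd hac.symm hbc.symm hcd hab had hbd
    by_cases h4 : d = u
    · subst h4; exact clique a ha b hb c hc had.symm hbd.symm hcd.symm hab hac hbc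
    exact h.noK4 a (by grind) b (by grind) c (by grind) d (by grind) hab hac had hbc hbd hcd
  · intro S hS h3
    refine h.cubic S ?_ h3
    refine Finset.subset_erase.2 ⟨hS, fun huS => key S hS (h3 u huS)⟩

section Glue

variable [DecidableEq V] {H : SimpleGraph V} {a b : V}

lemma glue_adj_of_ne {x y : V} (hx : x ≠ a) (hy : y ≠ a) :
    (quotGraph H (glue a b)).Adj x y ↔ H.Adj x y ∧ x ≠ b ∧ y ≠ b := by
  constructor
  · rintro ⟨h, p, q, hpq, rfl, rfl⟩
    unfold glue at *
    grind
  · rintro ⟨h, h1, h2⟩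
    exact ⟨h.ne, x, y, h, by simp [glue, h1], by simp [glue, h2]⟩

lemma glue_adj_left (hab : ¬ H.Adj a b) {y : V} :
    (quotGraph H (glue a b)).Adj a y ↔ (H.Adj a y ∨ H.Adj b y) := by
  constructor
  · rintro ⟨h, p, q, hpq, h1, rfl⟩
    unfold glue at *
    grind [SimpleGraph.adj_comm]
  · rintro (h | h)
    · have : y ≠ b := fun e => hab (e ▸ h)
      exact ⟨h.ne, a, y, h, by simp [glue], by simp [glue, this]⟩
    · have : y ≠ b := h.ne'
      have : a ≠ y := fun e => hab (e ▸ h.symm)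
      exact ⟨this, b, y, h, by simp [glue], by simp [glue, *]⟩

/-- The quotient keeps the vertex set: `b` remains as an isolated vertex, which is harmless for
niceness. -/
lemma glue_not_adj (hne : a ≠ b) (y : V) : ¬ (quotGraph H (glue a b)).Adj b y := by
  rintro ⟨h, p, q, hpq, h1, h2⟩
  unfold glue at h1
  grind

/-- A vertex of degree at most `3` that still has degree `3` after gluing keeps all its edges. -/
lemma glue_neighbors {U S : Finset V} {s : V} (hab : ¬ H.Adj a b) (hSU : S ⊆ U)
    (ha' : a ∈ U) (hb' : b ∈ U) (hne : a ≠ b)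
    (hsa : s ≠ a) (hdeg : degIn H U s ≤ 3)
    (h3 : 3 ≤ degIn (quotGraph H (glue a b)) S s) :
    degIn (quotGraph H (glue a b)) S s ≤ 3 ∧ (∀ x ∈ U, H.Adj s x → x ∈ S ∨ x = b) ∧
      ¬ (H.Adj s a ∧ H.Adj s b) := by
  classical
  unfold degIn at *
  set NS := S.filter ((quotGraph H (glue a b)).Adj s) with hNS
  set NU := U.filter (H.Adj s) with hNU
  -- Apart from `a`, the new neighbours of `s` are old neighbours other than `a` and `b`. The rest
  -- is counting: since `s` has at most three old neighbours, a loss through merging or through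
  -- leaving `S` would put its new degree below `3`.
  have hsub : NS.erase a ⊆ (NU.erase a).erase b := by
    intro x hx
    simp only [hNS, hNU, Finset.mem_erase, Finset.mem_filter] at hx ⊢
    have := (glue_adj_of_ne hsa hx.1).1 hx.2.2
    exact ⟨this.2.2, hx.1, hSU hx.2.1, this.1⟩
  have memNU : ∀ x, x ∈ NU ↔ x ∈ U ∧ H.Adj s x := fun x => by simp [hNU]
  have memNS : ∀ x, x ∈ NS → x ∈ S := fun x hx => (Finset.mem_filter.1 hx).1
  have haNS : a ∈ NS → H.Adj s a ∨ H.Adj s b := by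
    intro h
    have := (Finset.mem_filter.1 h).2
    rw [SimpleGraph.adj_comm, glue_adj_left hab] at this
    simpa [SimpleGraph.adj_comm] using this
  have hcard := Finset.card_le_card hsub
  have e1 := Finset.card_erase_add_one (s := NU) (a := a)
  have e2 := Finset.card_erase_add_one (s := NU.erase a) (a := b)
  have e3 := Finset.card_erase_add_one (s := NS) (a := a)
  have n1 := Finset.card_erase_le (s := NU) (a := a)
  have n2 := Finset.card_erase_le (s := NU.erase a) (a := b)
  have hnot : ¬ (H.Adj s a ∧ H.Adj s b) := by
    rintro ⟨h1, h2⟩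
    have := e1 ((memNU a).2 ⟨ha', h1⟩)
    have := e2 (Finset.mem_erase.2 ⟨hne.symm, (memNU b).2 ⟨hb', h2⟩⟩)
    by_cases h : a ∈ NS
    · have := e3 h; omega
    · rw [Finset.erase_eq_of_notMem h] at hcard; omega
  refine ⟨?_, ?_, hnot⟩
  · by_cases h : a ∈ NS
    · have := e3 h
      rcases haNS h with h1 | h1
      · have := e1 ((memNU a).2 ⟨ha', h1⟩)
        omega
      · have := e2 (Finset.mem_erase.2 ⟨hne.symm, (memNU b).2 ⟨hb', h1⟩⟩)
        omega
    · rw [Finset.erase_eq_of_notMem h] at hcard; omega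
  · intro x hxU hsx
    have hx := (memNU x).2 ⟨hxU, hsx⟩
    by_contra hcon
    rw [not_or] at hcon
    by_cases h : a ∈ NS
    · have h0 := e3 h
      have hxa : x ≠ a := by rintro rfl; exact hcon.1 (memNS _ h)
      have hle : (NS.erase a).card ≤ (((NU.erase a).erase b).erase x).card := by
        apply Finset.card_le_card
        intro y hy
        refine Finset.mem_erase.2 ⟨?_, hsub hy⟩
        rintro rfl
        exact hcon.1 (memNS _ (Finset.mem_of_mem_erase hy))
      have hx' : x ∈ (NU.erase a).erase b := by grind
      rw [Finset.card_erase_of_mem hx'] at hle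
      have : 0 < ((NU.erase a).erase b).card := Finset.card_pos.2 ⟨x, hx'⟩
      rcases haNS h with h1 | h1
      · have := e1 ((memNU a).2 ⟨ha', h1⟩)
        omega
      · have := e2 (Finset.mem_erase.2 ⟨hne.symm, (memNU b).2 ⟨hb', h1⟩⟩)
        omega
    · rw [Finset.erase_eq_of_notMem h] at hsub
      have hle : NS.card ≤ (NU.erase x).card := by
        apply Finset.card_le_card
        intro y hy
        refine Finset.mem_erase.2 ⟨?_, by have := hsub hy; grind⟩
        rintro rfl
        exact hcon.1 (memNS _ hy)
      rw [Finset.card_erase_of_mem hx] at hle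
      have : 0 < NU.card := Finset.card_pos.2 ⟨x, hx⟩
      omega

/-- The only edges that leave `T` are `va` and `vb`. -/
structure TwoEdgeCut (H : SimpleGraph V) (U : Finset V) (v a b : V) (T : Finset V) : Prop where
  left_mem : a ∈ T
  right_mem : b ∈ T
  notMem : v ∉ T
  edge : ∀ t ∈ T, ∀ x ∈ U, H.Adj t x → x ∈ T ∨ (x = v ∧ (t = a ∨ t = b))

/-- Let `S` have minimum degree at least `3` in the quotient. By `glue_neighbors`, its vertices
other than `a` have degree `3` and keep all their neighbours, and `v` is not among them. The merged
vertex has at most 2 + 2 neighbours besides `v`; if it has four in `S`, then `S` together with `b`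
is a forbidden cut. The hypothesis `hK` excludes a K₄ through the merged vertex. -/
lemma glue_niceOn {U : Finset V} {v : V} (hdeg : ∀ u ∈ U, degIn H U u ≤ 3) (ha : a ∈ U)
    (hb : b ∈ U) (hv : v ∈ U) (hne : a ≠ b) (hab : ¬ H.Adj a b) (hva : H.Adj v a)
    (hvb : H.Adj v b) (hcut : ∀ T ⊆ U, ¬ TwoEdgeCut H U v a b T)
    (hK : ∀ p ∈ U, ∀ q ∈ U, ∀ r ∈ U, H.Adj p q → H.Adj p r → H.Adj q r →
      (H.Adj a p ∨ H.Adj b p) → (H.Adj a q ∨ H.Adj b q) → (H.Adj a r ∨ H.Adj b r) → False)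
    (hH : NiceOn H U) :
    NiceOn (quotGraph H (glue a b)) U := by
  classical
  have hba : ¬ H.Adj b a := fun h => hab h.symm
  have adjb : ∀ y, ¬ (quotGraph H (glue a b)).Adj b y := glue_not_adj hne
  have adja : ∀ y, (quotGraph H (glue a b)).Adj a y ↔ (H.Adj a y ∨ H.Adj b y) :=
    fun y => glue_adj_left hab
  have adj : ∀ x y, x ≠ a → y ≠ a → (quotGraph H (glue a b)).Adj x y → H.Adj x y :=
    fun x y hx hy h => ((glue_adj_of_ne hx hy).1 h).1
  refine ⟨?_, ?_⟩
  · have clique : ∀ p ∈ U, ∀ q ∈ U, ∀ r ∈ U, (quotGraph H (glue a b)).Adj a p →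
        (quotGraph H (glue a b)).Adj a q → (quotGraph H (glue a b)).Adj a r →
        (quotGraph H (glue a b)).Adj p q → (quotGraph H (glue a b)).Adj p r →
        (quotGraph H (glue a b)).Adj q r → False := by
      intro p hp q hq r hr h1 h2 h3 h4 h5 h6
      exact hK p hp q hq r hr (adj _ _ h1.ne' h2.ne' h4) (adj _ _ h1.ne' h3.ne' h5)
        (adj _ _ h2.ne' h3.ne' h6) ((adja _).1 h1) ((adja _).1 h2) ((adja _).1 h3)
    intro p hp q hq r hr s hs hpq hpr hps hqr hqs hrs
    by_cases h1 : p = a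
    · subst h1; exact clique q hq r hr s hs hpq hpr hps hqr hqs hrs
    by_cases h2 : q = a
    · subst h2; exact clique p hp r hr s hs hpq.symm hqr hqs hpr hps hrs
    by_cases h3 : r = a
    · subst h3; exact clique p hp q hq s hs hpr.symm hqr.symm hrs hpq hps hqs
    by_cases h4 : s = a
    · subst h4; exact clique p hp q hq r hr hps.symm hqs.symm hrs.symm hpq hpr hqr
    exact hH.noK4 p hp q hq r hr s hs (adj _ _ h1 h2 hpq) (adj _ _ h1 h3 hpr)
      (adj _ _ h1 h4 hps) (adj _ _ h2 h3 hqr) (adj _ _ h2 h4 hqs) (adj _ _ h3 h4 hrs)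
  · intro S hSU h3 s hs
    have hbS : b ∉ S := by
      intro h
      have := h3 b h
      rw [degIn, Finset.filter_false_of_mem (fun y _ => adjb y)] at this
      simp at this
    have key : ∀ t ∈ S, t ≠ a → _ := fun t ht hta => glue_neighbors hab hSU ha hb hne hta
      (hdeg t (hSU ht)) (h3 t ht)
    by_cases hsa : s = a
    swap
    · exact (key s hs hsa).1
    subst hsa
    by_contra hlt
    have hvS : v ∉ S := fun h => (key v h hva.ne).2.2 ⟨hva, hvb⟩
    have hsub : S.filter ((quotGraph H (glue s b)).Adj s) ⊆
        (U.filter (H.Adj s)).erase v ∪ (U.filter (H.Adj b)).erase v := by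
      intro x hx
      rw [Finset.mem_filter, adja] at hx
      have := hSU hx.1
      have : x ≠ v := fun e => hvS (e ▸ hx.1)
      simp only [Finset.mem_union, Finset.mem_erase, Finset.mem_filter]
      tauto
    have h1 : ((U.filter (H.Adj s)).erase v).card + 1 ≤ 3 := by
      rw [Finset.card_erase_add_one (by simp [hv, hva.symm])]
      exact hdeg s ha
    have h2 : ((U.filter (H.Adj b)).erase v).card + 1 ≤ 3 := by
      rw [Finset.card_erase_add_one (by simp [hv, hvb.symm])]
      exact hdeg b hb
    have h4 := Finset.card_union_le ((U.filter (H.Adj s)).erase v) ((U.filter (H.Adj b)).erase v)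
    -- Degree at least `4` forces equality: all neighbours of both merged vertices, except `v`, lie
    -- in `S`.
    have heq := Finset.eq_of_subset_of_card_le hsub (by unfold degIn at hlt; omega)
    have hin : ∀ x ∈ U, x ≠ v → (H.Adj s x ∨ H.Adj b x) → x ∈ S := by
      intro x hx hxv h
      have : x ∈ S.filter ((quotGraph H (glue s b)).Adj s) := by
        rw [heq]
        simp only [Finset.mem_union, Finset.mem_erase, Finset.mem_filter]
        tauto
      exact (Finset.mem_filter.1 this).1
    refine hcut (insert b S) (Finset.insert_subset hb hSU)
      ⟨by simp [hs], by simp, by simp [hvS, hvb.ne], ?_⟩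
    intro t ht x hx htx
    rcases Finset.mem_insert.1 ht with rfl | ht
    · by_cases hxv : x = v
      · right; simp [hxv]
      · left; exact Finset.mem_insert_of_mem (hin x hx hxv (Or.inr htx))
    · by_cases hts : t = s
      · subst hts
        by_cases hxv : x = v
        · right; simp [hxv]
        · left; exact Finset.mem_insert_of_mem (hin x hx hxv (Or.inl htx))
      · left
        have := (key t ht hts).2.1 x hx htx
        simpa [or_comm] using this

end Glue

/-! ### Cubic graphs -/

section Cubic

variable [DecidableEq V] {H : SimpleGraph V} {U : Finset V}

lemma exists_three_neighbors {v : V} (h : degIn H U v = 3) :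
    ∃ p q r, p ≠ q ∧ p ≠ r ∧ q ≠ r ∧ p ∈ U ∧ q ∈ U ∧ r ∈ U ∧ H.Adj v p ∧ H.Adj v q ∧ H.Adj v r ∧
      ∀ x ∈ U, H.Adj v x → x = p ∨ x = q ∨ x = r := by
  classical
  obtain ⟨p, q, r, h1, h2, h3, h4⟩ := Finset.card_eq_three.1 h
  have key : ∀ x, (x ∈ U ∧ H.Adj v x) ↔ (x = p ∨ x = q ∨ x = r) := fun x => by
    have := Finset.ext_iff.1 h4 x
    simpa using this
  refine ⟨p, q, r, h1, h2, h3, ((key p).2 (by simp)).1, ((key q).2 (by simp)).1,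
    ((key r).2 (by simp)).1, ((key p).2 (by simp)).2, ((key q).2 (by simp)).2,
    ((key r).2 (by simp)).2, fun x hx hvx => (key x).1 ⟨hx, hvx⟩⟩

/-- The third neighbour of a vertex with two given neighbours. -/
lemma exists_third_neighbor {v p q : V} (h : degIn H U v = 3) (hp : p ∈ U) (hq : q ∈ U)
    (hpq : p ≠ q) (hvp : H.Adj v p) (hvq : H.Adj v q) :
    ∃ r, r ≠ p ∧ r ≠ q ∧ r ∈ U ∧ H.Adj v r ∧
      ∀ x ∈ U, H.Adj v x → x = p ∨ x = q ∨ x = r := by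
  obtain ⟨x, y, z, h1, h2, h3, hx, hy, hz, h4, h5, h6, h7⟩ := exists_three_neighbors h
  rcases h7 p hp hvp with rfl | rfl | rfl <;> rcases h7 q hq hvq with rfl | rfl | rfl <;>
    grind

/-- With `y` in the role of `v`, the edge `yz` excludes a cut. A new K₄ would need a triangle of
neighbours of `b` or `x`; it avoids `y` and `z`, and only the third neighbours of `b` and `x` are
left, one too few. -/
lemma exists_glue_of_diamond (hH : NiceOn H U) (hdeg : ∀ u ∈ U, degIn H U u = 3) {b x y z : V}
    (hb : b ∈ U) (hx : x ∈ U) (hy : y ∈ U) (hz : z ∈ U) (hne : b ≠ x) (hbx : ¬ H.Adj b x)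
    (hyz : H.Adj y z) (hby : H.Adj b y) (hbz : H.Adj b z) (hxy : H.Adj x y) (hxz : H.Adj x z) :
    NiceOn (quotGraph H (glue b x)) U := by
  refine glue_niceOn (fun u hu => (hdeg u hu).le) hb hx hy hne hbx hby.symm hxy.symm ?_ ?_ hH
  · rintro T hT ⟨h1, h2, h3, h4⟩
    have hzT : z ∈ T := (h4 b h1 z hz hbz).resolve_right fun h => hyz.ne' h.1
    rcases (h4 z hzT y hy hyz.symm).resolve_left h3 with ⟨-, h | h⟩
    · exact hbz.ne' h
    · exact hxz.ne' h
  · obtain ⟨b', -, -, -, -, hb'⟩ := exists_third_neighbor (hdeg b hb) hy hz hyz.ne hby hbz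
    obtain ⟨x', -, -, -, -, hx'⟩ := exists_third_neighbor (hdeg x hx) hy hz hyz.ne hxy hxz
    obtain ⟨y', hy1, hy2, -, -, hy'⟩ := exists_third_neighbor (hdeg y hy) hb hx hne hby.symm hxy.symm
    obtain ⟨z', hz1, hz2, -, -, hz'⟩ := exists_third_neighbor (hdeg z hz) hb hx hne hbz.symm hxz.symm
    have ey : y' = z := by have := hy' z hz hyz; grind [hbz.ne', hxz.ne']
    have ez : z' = y := by have := hz' y hy hyz.symm; grind [hby.ne', hxy.ne']
    -- From here on `y'` stands for `z`, and `z'` for `y`.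
    subst ey ez
    have nb : ¬ H.Adj b b := H.irrefl
    have nx : ¬ H.Adj x x := H.irrefl
    have nbx : ¬ H.Adj x b := fun h => hbx h.symm
    have far : ∀ p ∈ U, ∀ q ∈ U, ∀ r ∈ U, H.Adj p q → H.Adj p r → q ≠ r →
        (H.Adj b q ∨ H.Adj x q) → (H.Adj b r ∨ H.Adj x r) → p ≠ y' ∧ p ≠ z' := by
      intro p hp q hq r hr hpq hpr hqr h2 h3
      constructor <;> rintro rfl
      · have := hz' q hq hpq
        have := hz' r hr hpr
        grind
      · have := hy' q hq hpq
        have := hy' r hr hpr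
        grind
    intro p hp q hq r hr hpq hpr hqr h1 h2 h3
    have f1 := far p hp q hq r hr hpq hpr hqr.ne h2 h3
    have f2 := far q hq p hp r hr hpq.symm hqr hpr.ne h1 h3
    have f3 := far r hr p hp q hq hpr.symm hqr.symm hpq.ne h1 h2
    have g : ∀ w ∈ U, w ≠ y' ∧ w ≠ z' → (H.Adj b w ∨ H.Adj x w) → w = b' ∨ w = x' := by
      intro w hw h h'
      rcases h' with h' | h'
      · have := hb' w hw h'; grind
      · have := hx' w hw h'; grind
    have g1 := g p hp f1 h1
    have g2 := g q hq f2 h2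
    have g3 := g r hr f3 h3
    have := hpq.ne
    have := hpr.ne
    have := hqr.ne
    grind

/-- Descent on the size of the cut `T`. The two neighbours `x`, `y` of `a` other than `v` lie in
`T`. If they are adjacent, the path `v`, `a`, `x` has no cut, because of the triangle `a`, `x`, `y`.
Otherwise the path `x`, `a`, `y` has no cut or has a cut `T'`, and then `T' ∩ T` is a cut that
misses `a`, hence is smaller than `T`. -/
lemma exists_uncut (hdeg : ∀ u ∈ U, degIn H U u = 3) :
    ∀ (k : ℕ) (T : Finset V) (v a b : V), T.card ≤ k → T ⊆ U → TwoEdgeCut H U v a b T → v ∈ U →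
      a ≠ b → ¬ H.Adj a b → H.Adj v a → H.Adj v b →
      ∃ v ∈ U, ∃ a ∈ U, ∃ b ∈ U, a ≠ b ∧ ¬ H.Adj a b ∧ H.Adj v a ∧ H.Adj v b ∧
        ∀ T ⊆ U, ¬ TwoEdgeCut H U v a b T := by
  intro k
  induction k with
  | zero =>
    intro T v a b hT _ h
    simp only [nonpos_iff_eq_zero, Finset.card_eq_zero] at hT
    simpa [hT] using h.left_mem
  | succ k ih =>
    intro T v a b hT hTU hcut hv hne hab hva hvb
    have ha := hTU hcut.left_mem
    obtain ⟨p, q, r, hpq, hpr, hqr, hp, hq, hr, hap, haq, har, -⟩ :=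
      exists_three_neighbors (hdeg a ha)
    obtain ⟨x, y, hxy, hxv, hyv, hx, hy, hax, hay⟩ : ∃ x y, x ≠ y ∧ x ≠ v ∧ y ≠ v ∧ x ∈ U ∧
        y ∈ U ∧ H.Adj a x ∧ H.Adj a y := by
      by_cases h1 : p = v
      · exact ⟨q, r, hqr, by grind, by grind, hq, hr, haq, har⟩
      by_cases h2 : q = v
      · exact ⟨p, r, hpr, by grind, by grind, hp, hr, hap, har⟩
      exact ⟨p, q, hpq, h1, h2, hp, hq, hap, haq⟩
    have hxT : x ∈ T := (hcut.edge a hcut.left_mem x hx hax).resolve_right fun h => hxv h.1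
    have hyT : y ∈ T := (hcut.edge a hcut.left_mem y hy hay).resolve_right fun h => hyv h.1
    by_cases hadj : H.Adj x y
    · have hvx : ¬ H.Adj v x := by
        intro h
        rcases (hcut.edge x hxT v hv h.symm).resolve_left hcut.notMem with ⟨-, h' | h'⟩
        · exact hax.ne' h'
        · exact hab (h' ▸ hax)
      refine ⟨a, ha, v, hv, x, hx, hxv.symm, hvx, hva.symm, hax, ?_⟩
      rintro T' - h'
      have hyT' : y ∈ T' :=
        (h'.edge x h'.right_mem y hy hadj).resolve_right fun h => hay.ne' h.1
      rcases (h'.edge y hyT' a ha hay.symm).resolve_left h'.notMem with ⟨-, h | h⟩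
      · exact hyv h
      · exact hxy h.symm
    · by_cases hgood : ∀ T ⊆ U, ¬ TwoEdgeCut H U a x y T
      · exact ⟨a, ha, x, hx, y, hy, hxy, hadj, hax, hay, hgood⟩
      push Not at hgood
      obtain ⟨T', hT'U, h'⟩ := hgood
      have hvT' : v ∉ T' := by
        intro hvT'
        rcases (h'.edge v hvT' a ha hva).resolve_left h'.notMem with ⟨-, h | h⟩
        · exact hxv h.symm
        · exact hyv h.symm
      refine ih (T' ∩ T) a x y ?_ (Finset.inter_subset_right.trans hTU) ?_ ha hxy hadj hax hay
      · have : (T' ∩ T).card < T.card := by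
          apply Finset.card_lt_card
          refine Finset.ssubset_iff_subset_ne.2 ⟨Finset.inter_subset_right, fun e => h'.notMem ?_⟩
          have := hcut.left_mem
          rw [← e] at this
          exact (Finset.mem_inter.1 this).1
        omega
      · refine ⟨Finset.mem_inter.2 ⟨h'.left_mem, hxT⟩, Finset.mem_inter.2 ⟨h'.right_mem, hyT⟩,
          fun h => h'.notMem (Finset.mem_inter.1 h).1, ?_⟩
        intro t ht w hw htw
        rw [Finset.mem_inter] at ht ⊢
        rcases h'.edge t ht.1 w hw htw with h1 | h1
        -- An edge that leaves `T` ends in `v`, but `v` is outside `T'`; so an edge inside `T'`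
        -- stays in `T`.
        · rcases hcut.edge t ht.2 w hw htw with h2 | ⟨rfl, -⟩
          · exact Or.inl ⟨h1, h2⟩
          · exact absurd h1 hvT'
        · exact Or.inr h1

/-- Brooks' theorem for cubic graphs, in one step: two nonadjacent vertices can be identified. -/
lemma exists_glue_of_cubic (hH : NiceOn H U) (hU : U.Nonempty) (hdeg : ∀ u ∈ U, degIn H U u = 3) :
    ∃ a ∈ U, ∃ b ∈ U, a ≠ b ∧ ¬ H.Adj a b ∧ NiceOn (quotGraph H (glue a b)) U := by
  by_cases hd : ∃ b ∈ U, ∃ x ∈ U, ∃ y ∈ U, ∃ z ∈ U, b ≠ x ∧ ¬ H.Adj b x ∧ H.Adj y z ∧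
      H.Adj b y ∧ H.Adj b z ∧ H.Adj x y ∧ H.Adj x z
  · obtain ⟨b, hb, x, hx, y, hy, z, hz, h1, h2, h3, h4, h5, h6, h7⟩ := hd
    exact ⟨b, hb, x, hx, h1, h2, exists_glue_of_diamond hH hdeg hb hx hy hz h1 h2 h3 h4 h5 h6 h7⟩
  have hd' : ∀ b ∈ U, ∀ x ∈ U, ∀ y ∈ U, ∀ z ∈ U, b ≠ x → ¬ H.Adj b x → H.Adj y z →
      H.Adj b y → H.Adj b z → H.Adj x y → H.Adj x z → False :=
    fun b hb x hx y hy z hz h1 h2 h3 h4 h5 h6 h7 =>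
      hd ⟨b, hb, x, hx, y, hy, z, hz, h1, h2, h3, h4, h5, h6, h7⟩
  obtain ⟨v, hv, a, ha, b, hb, hne, hab, hva, hvb, hcut⟩ : ∃ v ∈ U, ∃ a ∈ U, ∃ b ∈ U, a ≠ b ∧
      ¬ H.Adj a b ∧ H.Adj v a ∧ H.Adj v b ∧ ∀ T ⊆ U, ¬ TwoEdgeCut H U v a b T := by
    obtain ⟨v, hv⟩ := hU
    obtain ⟨p, q, r, hpq, hpr, hqr, hp, hq, hr, hvp, hvq, hvr, -⟩ :=
      exists_three_neighbors (hdeg v hv)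
    obtain ⟨a, ha, b, hb, hne, hab, hva, hvb⟩ : ∃ a ∈ U, ∃ b ∈ U, a ≠ b ∧ ¬ H.Adj a b ∧
        H.Adj v a ∧ H.Adj v b := by
      by_cases h1 : H.Adj p q
      · by_cases h2 : H.Adj p r
        · by_cases h3 : H.Adj q r
          · exact (hH.noK4 v hv p hp q hq r hr hvp hvq hvr h1 h2 h3).elim
          · exact ⟨q, hq, r, hr, hqr, h3, hvq, hvr⟩
        · exact ⟨p, hp, r, hr, hpr, h2, hvp, hvr⟩
      · exact ⟨p, hp, q, hq, hpq, h1, hvp, hvq⟩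
    by_cases hgood : ∀ T ⊆ U, ¬ TwoEdgeCut H U v a b T
    · exact ⟨v, hv, a, ha, b, hb, hne, hab, hva, hvb, hgood⟩
    push Not at hgood
    obtain ⟨T, hTU, hT⟩ := hgood
    exact exists_uncut hdeg T.card T v a b le_rfl hTU hT hv hne hab hva hvb
  refine ⟨a, ha, b, hb, hne, hab, glue_niceOn (fun u hu => (hdeg u hu).le) ha hb hv hne hab hva hvb
    hcut ?_ hH⟩
  -- A vertex outside a triangle with two neighbours on it would give a K₄ or a diamond.
  have two : ∀ c ∈ U, ∀ p ∈ U, ∀ q ∈ U, ∀ r ∈ U, H.Adj p q → H.Adj p r → H.Adj q r →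
      H.Adj c p → H.Adj c q → c ≠ r → False := by
    intro c hc p hp q hq r hr hpq hpr hqr hcp hcq hcr
    by_cases h : H.Adj c r
    · exact hH.noK4 c hc p hp q hq r hr hcp hcq h hpq hpr hqr
    · exact hd' c hc r hr p hp q hq hcr h hpq hcp hcq hpr.symm hqr.symm
  intro p hp q hq r hr hpq hpr hqr h1 h2 h3
  have hba : ¬ H.Adj b a := fun h => hab h.symm
  have na : ∀ w, (H.Adj a w ∨ H.Adj b w) → a ≠ w := by
    rintro w h rfl
    exact h.elim H.irrefl hba
  have nb : ∀ w, (H.Adj a w ∨ H.Adj b w) → b ≠ w := by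
    rintro w h rfl
    exact h.elim hab H.irrefl
  -- By pigeonhole, `a` or `b` is adjacent to two of the three vertices of the triangle.
  rcases h1 with h1' | h1' <;> rcases h2 with h2' | h2'
  · exact two a ha p hp q hq r hr hpq hpr hqr h1' h2' (na r h3)
  · rcases h3 with h3' | h3'
    · exact two a ha p hp r hr q hq hpr hpq hqr.symm h1' h3' (na q (.inr h2'))
    · exact two b hb q hq r hr p hp hqr hpq.symm hpr.symm h2' h3' (nb p (.inl h1'))
  · rcases h3 with h3' | h3'
    · exact two a ha q hq r hr p hp hqr hpq.symm hpr.symm h2' h3' (na p (.inr h1'))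
    · exact two b hb p hp r hr q hq hpr hpq hqr.symm h1' h3' (nb q (.inl h2'))
  · exact two b hb p hp q hq r hr hpq hpr hqr h1' h2' (nb r h3)

/-- The new neighbours of `u` are images of old ones under `glue a b`; `b ∈ S` ensures that the
preimage of `a` is counted. -/
lemma degIn_glue_le {a b u : V} {S : Finset V} (hu : u ≠ a) (hb : b ∈ S) :
    degIn (quotGraph H (glue a b)) S u ≤ degIn H S u := by
  classical
  have : S.filter ((quotGraph H (glue a b)).Adj u) ⊆ (S.filter (H.Adj u)).image (glue a b) := by
    intro x hx
    obtain ⟨hxS, h, p, q, hpq, h1, h2⟩ := Finset.mem_filter.1 hx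
    unfold glue at *
    refine Finset.mem_image.2 ⟨q, ?_, h2⟩
    simp only [Finset.mem_filter]
    grind
  exact (Finset.card_le_card this).trans Finset.card_image_le

/-- In a nice graph with at least four vertices, two nonadjacent vertices can be identified. -/
theorem exists_glue : ∀ (k : ℕ) (U : Finset V), U.card = k → 4 ≤ k → NiceOn H U →
    ∃ a ∈ U, ∃ b ∈ U, a ≠ b ∧ ¬ H.Adj a b ∧ NiceOn (quotGraph H (glue a b)) U := by
  classical
  intro k
  induction k with
  | zero => intro U _ h; omega
  | succ k ih =>
    intro U hcard hk hH
    by_cases hlow : ∃ u ∈ U, degIn H U u ≤ 2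
    swap
    · push Not at hlow
      refine exists_glue_of_cubic hH (Finset.card_pos.1 (by omega)) fun u hu => ?_
      exact le_antisymm (hH.cubic U subset_rfl (fun v hv => hlow v hv) u hu) (hlow u hu)
    obtain ⟨u, hu, hdeg⟩ := hlow
    have hcard' : (U.erase u).card = k := by rw [Finset.card_erase_of_mem hu]; omega
    by_cases hk4 : 4 ≤ k
    · obtain ⟨a, ha, b, hb, hne, hab, hnice⟩ :=
        ih (U.erase u) hcard' hk4 (hH.mono (Finset.erase_subset _ _))
      refine ⟨a, Finset.mem_of_mem_erase ha, b, Finset.mem_of_mem_erase hb, hne, hab,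
        hnice.insert_of_degIn ((degIn_glue_le ?_ ?_).trans hdeg)⟩
      · exact (Finset.ne_of_mem_erase ha).symm
      · exact Finset.mem_of_mem_erase hb
    -- Here `U` has exactly four vertices, so `u` misses one of the other three. After gluing, only
    -- three vertices are not isolated, too few for a K₄ or a degree above `3`.
    · obtain ⟨x, hx, hux⟩ : ∃ x ∈ U.erase u, ¬ H.Adj u x := by
        by_contra! hall
        have : U.erase u ⊆ U.filter (H.Adj u) := fun y hy =>
          Finset.mem_filter.2 ⟨Finset.mem_of_mem_erase hy, hall y hy⟩
        have := Finset.card_le_card this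
        unfold degIn at hdeg
        omega
      have hne : u ≠ x := (Finset.ne_of_mem_erase hx).symm
      refine ⟨u, hu, x, Finset.mem_of_mem_erase hx, hne, hux, ?_⟩
      have small : ∀ v, degIn (quotGraph H (glue u x)) (U.erase x) v ≤ 3 := fun v => by
        have := Finset.card_filter_le (U.erase x) ((quotGraph H (glue u x)).Adj v)
        rw [Finset.card_erase_of_mem (Finset.mem_of_mem_erase hx)] at this
        exact this.trans (by omega)
      apply NiceOn.insert_of_degIn (u := x)
      · refine ⟨?_, fun S hS _ v _ => (degIn_mono _ hS v).trans (small v)⟩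
        intro p hp q hq r hr s hs h1 h2 h3 h4 h5 h6
        have hsub : ({p, q, r, s} : Finset V) ⊆ U.erase x := by
          intro w; simp only [Finset.mem_insert, Finset.mem_singleton]
          rintro (rfl | rfl | rfl | rfl) <;> assumption
        have := Finset.card_le_card hsub
        rw [Finset.card_erase_of_mem (Finset.mem_of_mem_erase hx),
          Finset.card_insert_of_notMem (by simp [h1.ne, h2.ne, h3.ne]),
          Finset.card_eq_three.2 ⟨q, r, s, h4.ne, h5.ne, h6.ne, rfl⟩] at this
        omega
      · rw [degIn, Finset.filter_false_of_mem (fun y _ => glue_not_adj hne y)]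
        simp

end Cubic

/-! ### For-programs -/

@[simp] lemma Memory.setVar_var (s : Memory) (x v y : ℕ) :
    (s.setVar x v).var y = if y = x then v else s.var y := rfl

@[simp] lemma Memory.setVar_arr (s : Memory) (x v : ℕ) : (s.setVar x v).arr = s.arr := rfl

@[simp] lemma Memory.setArr_var (s : Memory) (a i j v : ℕ) : (s.setArr a i j v).var = s.var := rfl

@[simp] lemma Memory.setArr_arr (s : Memory) (a i j v a' i' j' : ℕ) :
    (s.setArr a i j v).arr a' i' j' = if a' = a ∧ i' = i ∧ j' = j then v else s.arr a' i' j' := rfl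

/-- Programs whose only loops are `for x < x₀ do c`. -/
inductive Cmd : Type
  | skip : Cmd
  | assign (x : ℕ) (e : Expr) : Cmd
  | store (a : ℕ) (i j e : Expr) : Cmd
  | seq (c₁ c₂ : Cmd) : Cmd
  | ite (e : Expr) (c₁ c₂ : Cmd) : Cmd
  | forLoop (x : ℕ) (c : Cmd) : Cmd

namespace Cmd

/-- The translation into programs. -/
def compile : Cmd → Prog
  | .skip => .skip
  | .assign x e => .assign x e
  | .store a i j e => .store a i j e
  | .seq c₁ c₂ => .seq c₁.compile c₂.compile
  | .ite e c₁ c₂ => .ite e c₁.compile c₂.compile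
  | .forLoop x c => .seq (.assign x (.const 0)) (.loop (.sub (.var 0) (.var x))
      (.seq c.compile (.assign x (.add (.var x) (.const 1)))))

/-- The memory after `k` passes of a for-loop with variable `x` and body `f`. -/
def iter (f : Memory → Memory) (x : ℕ) (s : Memory) : ℕ → Memory
  | 0 => s.setVar x 0
  | k + 1 => (f (iter f x s k)).setVar x (k + 1)

/-- The final memory. -/
def exec : Cmd → Memory → Memory
  | .skip, s => s
  | .assign x e, s => s.setVar x (e.eval s)
  | .store a i j e, s => s.setArr a (i.eval s) (j.eval s) (e.eval s)
  | .seq c₁ c₂, s => c₂.exec (c₁.exec s)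
  | .ite e c₁ c₂, s => if e.eval s ≠ 0 then c₁.exec s else c₂.exec s
  | .forLoop x c, s => iter c.exec x s (s.var 0)

/-- A bound for the number of steps, in terms of `x₀`. -/
noncomputable def bound : Cmd → Polynomial ℕ
  | .skip => 1
  | .assign _ e => .C (e.cost + 1)
  | .store _ i j e => .C (i.cost + j.cost + e.cost + 1)
  | .seq c₁ c₂ => c₁.bound + c₂.bound
  | .ite e c₁ c₂ => .C (e.cost + 1) + c₁.bound + c₂.bound
  | .forLoop _ c => .C 6 + .X * (.C 8 + c.bound)

/-- The variables that are assigned. -/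
def vars : Cmd → List ℕ
  | .skip => []
  | .assign x _ => [x]
  | .store _ _ _ _ => []
  | .seq c₁ c₂ => c₁.vars ++ c₂.vars
  | .ite _ c₁ c₂ => c₁.vars ++ c₂.vars
  | .forLoop x c => x :: c.vars

/-- The arrays that are written. -/
def arrs : Cmd → List ℕ
  | .skip => []
  | .assign _ _ => []
  | .store a _ _ _ => [a]
  | .seq c₁ c₂ => c₁.arrs ++ c₂.arrs
  | .ite _ c₁ c₂ => c₁.arrs ++ c₂.arrs
  | .forLoop _ c => c.arrs

/-- Loop variables are not assigned in the body of the loop, and `x₀` is never assigned. -/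
def WellFormed : Cmd → Prop
  | .skip => True
  | .assign x _ => x ≠ 0
  | .store _ _ _ _ => True
  | .seq c₁ c₂ => c₁.WellFormed ∧ c₂.WellFormed
  | .ite _ c₁ c₂ => c₁.WellFormed ∧ c₂.WellFormed
  | .forLoop x c => x ≠ 0 ∧ x ∉ c.vars ∧ c.WellFormed

lemma WellFormed.zero_notMem {c : Cmd} (h : c.WellFormed) : 0 ∉ c.vars := by
  induction c with
  | skip => simp [vars]
  | assign x e => simpa [vars] using (show x ≠ 0 from h).symm
  | store a i j e => simp [vars]
  | seq c₁ c₂ h₁ h₂ => simp [vars, h₁ h.1, h₂ h.2]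
  | ite e c₁ c₂ h₁ h₂ => simp [vars, h₁ h.1, h₂ h.2]
  | forLoop x c hc => simpa [vars, hc h.2.2] using h.1.symm

/-- For a concrete command the side condition is decidable, so framing is settled by `decide` later
on. -/
lemma exec_var (c : Cmd) (s : Memory) (y : ℕ) (hy : y ∉ c.vars) :
    (c.exec s).var y = s.var y := by
  induction c generalizing s with
  | skip => rfl
  | assign x e => simp_all [vars, exec]
  | store a i j e => rfl
  | seq c₁ c₂ h₁ h₂ => simp_all [vars, exec]
  | ite e c₁ c₂ h₁ h₂ =>
    simp only [exec]
    split_ifs <;> simp_all [vars]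
  | forLoop x c hc =>
    simp only [vars, List.mem_cons, not_or] at hy
    have key : ∀ k, (iter c.exec x s k).var y = s.var y := by
      intro k
      induction k with
      | zero => simp [iter, hy.1]
      | succ k ih => simp [iter, hy.1, hc _ hy.2, ih]
    exact key _

lemma exec_arr (c : Cmd) (s : Memory) (a : ℕ) (ha : a ∉ c.arrs) :
    (c.exec s).arr a = s.arr a := by
  induction c generalizing s with
  | skip => rfl
  | assign x e => rfl
  | store a' i j e =>
    ext
    simp_all [exec, arrs]
  | seq c₁ c₂ h₁ h₂ => simp_all [arrs, exec]
  | ite e c₁ c₂ h₁ h₂ =>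
    simp only [exec]
    split_ifs <;> simp_all [arrs]
  | forLoop x c hc =>
    simp only [arrs] at ha
    have key : ∀ k, (iter c.exec x s k).arr a = s.arr a := by
      intro k
      induction k with
      | zero => simp [iter]
      | succ k ih => simp [iter, hc _ ha, ih]
    exact key _

lemma iter_var_self (f : Memory → Memory) (x : ℕ) (s : Memory) (k : ℕ) :
    (iter f x s k).var x = k := by
  cases k <;> simp [iter]

lemma iter_var (c : Cmd) (x : ℕ) (s : Memory) (k : ℕ) {y : ℕ} (hy : y ∉ (Cmd.forLoop x c).vars) :
    (iter c.exec x s k).var y = s.var y := by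
  simp only [vars, List.mem_cons, not_or] at hy
  induction k with
  | zero => simp [iter, hy.1]
  | succ k ih => simp [iter, hy.1, exec_var c _ y hy.2, ih]

lemma iter_arr (c : Cmd) (x : ℕ) (s : Memory) (k : ℕ) {a : ℕ} (ha : a ∉ c.arrs) :
    (iter c.exec x s k).arr a = s.arr a := by
  induction k with
  | zero => simp [iter]
  | succ k ih => simp [iter, exec_arr c _ a ha, ih]

/-- The compiled program computes `exec` within the bound. -/
theorem run_compile (c : Cmd) (hc : c.WellFormed) (s : Memory) :
    ∃ t, Run c.compile s t (c.exec s) ∧ t ≤ c.bound.eval (s.var 0) := by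
  induction c generalizing s with
  | skip => exact ⟨1, .skip s, by simp [bound]⟩
  | assign x e => exact ⟨_, .assign x e s, by simp [bound]⟩
  | store a i j e => exact ⟨_, .store a i j e s, by simp [bound]⟩
  | seq c₁ c₂ h₁ h₂ =>
    obtain ⟨t₁, r₁, b₁⟩ := h₁ hc.1 s
    obtain ⟨t₂, r₂, b₂⟩ := h₂ hc.2 (c₁.exec s)
    rw [exec_var c₁ s 0 hc.1.zero_notMem] at b₂
    exact ⟨_, .seq r₁ r₂, by simp only [bound, Polynomial.eval_add]; omega⟩
  | ite e c₁ c₂ h₁ h₂ =>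
    by_cases he : e.eval s = 0
    · obtain ⟨t, r, b⟩ := h₂ hc.2 s
      refine ⟨e.cost + 1 + t, ?_, ?_⟩
      · simp only [exec, he, ne_eq, not_true_eq_false, if_false]
        exact .ite_false he r
      · simp only [bound, Polynomial.eval_add, Polynomial.eval_C]; omega
    · obtain ⟨t, r, b⟩ := h₁ hc.1 s
      refine ⟨e.cost + 1 + t, ?_, ?_⟩
      · simp only [exec, he, ne_eq, not_false_eq_true, if_true]
        exact .ite_true he r
      · simp only [bound, Polynomial.eval_add, Polynomial.eval_C]; omega
  | forLoop x c ih =>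
    obtain ⟨hx, hxc, hwf⟩ := hc
    have h0 : ∀ k, (iter c.exec x s k).var 0 = s.var 0 := fun k =>
      iter_var c x s k (by simpa [vars, hx.symm] using hwf.zero_notMem)
    have loop : ∀ m k, k + m = s.var 0 → ∃ t,
        Run (.loop (.sub (.var 0) (.var x))
          (.seq c.compile (.assign x (.add (.var x) (.const 1)))))
          (iter c.exec x s k) t (iter c.exec x s (s.var 0)) ∧
        -- The final failing test costs `4`; each pass costs `4` for the test and `4` for the
        -- increment, besides the body.
        t ≤ 4 + m * (8 + c.bound.eval (s.var 0)) := by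
      intro m
      induction m with
      | zero =>
        rintro k hk
        obtain rfl : k = s.var 0 := by omega
        refine ⟨_, .loop_done ?_, by simp [Expr.cost]⟩
        simp [Expr.eval, h0, iter_var_self]
      | succ m ihm =>
        intro k hk
        obtain ⟨t₂, r₂, b₂⟩ := ihm (k + 1) (by omega)
        obtain ⟨t₁, r₁, b₁⟩ := ih hwf (iter c.exec x s k)
        rw [h0] at b₁
        have hstep : iter c.exec x s (k + 1) = (c.exec (iter c.exec x s k)).setVar x
            ((Expr.add (.var x) (.const 1)).eval (c.exec (iter c.exec x s k))) := by
          simp [iter, Expr.eval, exec_var c _ x hxc, iter_var_self]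
        have ra := Run.assign x (.add (.var x) (.const 1)) (c.exec (iter c.exec x s k))
        rw [← hstep] at ra
        refine ⟨_, .loop_step ?_ (.seq r₁ ra) r₂, ?_⟩
        · simp only [Expr.eval, h0, iter_var_self]
          omega
        · simp only [Expr.cost]
          rw [Nat.succ_mul]
          omega
    obtain ⟨t, r, b⟩ := loop (s.var 0) 0 (by omega)
    refine ⟨_, .seq (.assign x (.const 0) s) r, ?_⟩
    simp only [bound, Expr.cost, Polynomial.eval_add, Polynomial.eval_C, Polynomial.eval_mul,
      Polynomial.eval_X]
    omega

/-- Everything that `c` does not write is unchanged. -/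
def Frame (c : Cmd) (s s' : Memory) : Prop :=
  (∀ y ∉ c.vars, s'.var y = s.var y) ∧ ∀ a ∉ c.arrs, s'.arr a = s.arr a

/-- Induction along a for-loop. -/
lemma for_induction {x : ℕ} {c : Cmd} {s : Memory} (I : ℕ → Memory → Prop)
    (h0 : I 0 (s.setVar x 0))
    (hstep : ∀ k < s.var 0, ∀ s', Frame (.forLoop x c) s s' → s'.var x = k → I k s' →
      I (k + 1) ((c.exec s').setVar x (k + 1))) :
    I (s.var 0) ((Cmd.forLoop x c).exec s) := by
  have key : ∀ k ≤ s.var 0, I k (iter c.exec x s k) := by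
    intro k
    induction k with
    | zero => exact fun _ => h0
    | succ k ih =>
      intro hk
      exact hstep k hk _ ⟨fun y hy => iter_var c x s k hy, fun a ha => iter_arr c x s k ha⟩
        (iter_var_self _ _ _ _) (ih (by omega))
  exact key _ le_rfl

end Cmd

/-! ### Sweeps -/

/-- Apply `F 0`, …, `F (n - 1)` in this order. -/
def sweep {α : Type*} (F : ℕ → α → α) : ℕ → α → α
  | 0, s => s
  | n + 1, s => F n (sweep F n s)

lemma sweep_invariant {α : Type*} {F : ℕ → α → α} {n : ℕ} {p : α → Prop}
    (h : ∀ k < n, ∀ s, p s → p (F k s)) {s : α} (hs : p s) : p (sweep F n s) := by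
  induction n with
  | zero => exact hs
  | succ n ih => exact h n (by omega) _ (ih fun k hk => h k (by omega))

/-- The measure never increases, so one effective step makes the whole sweep lower it. -/
lemma sweep_fixed_or_lt {α : Type*} {F : ℕ → α → α} {n : ℕ} {μ : α → ℕ}
    (h : ∀ k < n, ∀ s, F k s = s ∨ μ (F k s) < μ s) (s : α) :
    (sweep F n s = s ∧ ∀ k < n, F k s = s) ∨ μ (sweep F n s) < μ s := by
  induction n with
  | zero => simp [sweep]
  | succ n ih =>
    have h1 := ih fun k hk => h k (by omega)
    have h2 := h n (by omega) (sweep F n s)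
    simp only [sweep]
    rcases h1 with ⟨h1, h3⟩ | h1
    · rw [h1] at h2 ⊢
      rcases h2 with h2 | h2
      · refine Or.inl ⟨h2, fun k hk => ?_⟩
        rcases Nat.lt_succ_iff_lt_or_eq.1 hk with hk | rfl
        · exact h3 k hk
        · exact h2
      · exact Or.inr h2
    · rcases h2 with h2 | h2
      · rw [h2]; exact Or.inr h1
      · exact Or.inr (h2.trans h1)

/-- If every application of `T` fixes the state or lowers a measure, then the state becomes
fixed. -/
lemma sweep_const_fixed {α : Type*} {T : α → α} {μ : α → ℕ} (h : ∀ s, T s = s ∨ μ (T s) < μ s)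
    (m : ℕ) (s : α) (hm : μ s ≤ m) : T (sweep (fun _ => T) m s) = sweep (fun _ => T) m s := by
  -- Before a fixed point is reached, every round lowers the measure by at least `1`.
  have key : ∀ m, T (sweep (fun _ => T) m s) = sweep (fun _ => T) m s ∨
      μ (sweep (fun _ => T) m s) + m ≤ μ s := by
    intro m
    induction m with
    | zero => right; simp [sweep]
    | succ m ih =>
      simp only [sweep]
      rcases ih with ih | ih
      · left; rw [ih, ih]
      · rcases h (sweep (fun _ => T) m s) with h1 | h1
        · left; rw [h1, h1]
        · right; omega
  rcases key m with h1 | h1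
  · exact h1
  · rcases h (sweep (fun _ => T) m s) with h2 | h2
    · exact h2
    · omega

namespace Cmd

lemma for_spec {x : ℕ} {c : Cmd} {s : Memory} {n : ℕ} (hn : s.var 0 = n) (I : ℕ → Memory → Prop)
    (h0 : I 0 (s.setVar x 0))
    (hstep : ∀ k < n, ∀ s', Frame (.forLoop x c) s s' → s'.var x = k → I k s' →
      I (k + 1) ((c.exec s').setVar x (k + 1))) :
    I n ((Cmd.forLoop x c).exec s) := by
  subst hn
  exact for_induction I h0 hstep

end Cmd

open Cmd

/-! ### The adjacency matrix of the quotient -/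

/-- `A₂ := 0`. -/
def clearCmd : Cmd :=
  .forLoop 1 (.forLoop 2 (.store 2 (.var 1) (.var 2) (.const 0)))

/-- Add to `A₂` the image of the edges of `A₀` at `x₁` under `x ↦ A₄[x, 0]`. -/
def imageRowCmd : Cmd :=
  .forLoop 2 (.ite (.get 0 (.var 1) (.var 2))
    (.store 2 (.get 4 (.var 1) (.const 0)) (.get 4 (.var 2) (.const 0)) (.const 1)) .skip)

/-- `A₂` becomes the adjacency matrix of the image of the graph under `x ↦ A₄[x, 0]`. -/
def quotCmd : Cmd := .seq clearCmd (.forLoop 1 imageRowCmd)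

lemma clearCmd_spec {s : Memory} {n : ℕ} (hn : s.var 0 = n) :
    ∀ i < n, ∀ j < n, (clearCmd.exec s).arr 2 i j = 0 := by
  refine for_spec hn (fun k s' => ∀ i < k, ∀ j < n, s'.arr 2 i j = 0) (by simp) ?_
  intro k hk s' hF hx hI
  have hn' : s'.var 0 = n := by rw [hF.1 0 (by decide), hn]
  have := for_spec (x := 2) (c := .store 2 (.var 1) (.var 2) (.const 0)) hn'
    (fun l s'' => ∀ i < k + 1, ∀ j < n, (i < k ∨ j < l) → s''.arr 2 i j = 0)
    (by
      intro i hi j hj h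
      exact hI i (by omega) j hj)
    (by
      intro l hl s'' hF' hx' hJ i hi j hj h
      have h1 : s''.var 1 = k := by rw [hF'.1 1 (by decide), hx]
      simp only [exec, Expr.eval, Memory.setVar_arr, Memory.setArr_arr, h1, hx', true_and]
      split_ifs with h2
      · rfl
      · exact hJ i hi j hj (by omega))
  intro i hi j hj
  exact this i hi j hj (Or.inr hj)

open scoped Classical in
-- Diagonal entries are kept, unlike in `quotGraph`: they reveal whether `f` is a proper coloring.
lemma quotCmd_spec {s : Memory} {n : ℕ} (hn : s.var 0 = n) {E : ℕ → ℕ → Prop}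
    (hE : ∀ x y, s.arr 0 x y ≠ 0 ↔ E x y) {f : ℕ → ℕ} (hf : ∀ x < n, s.arr 4 x 0 = f x) :
    ∀ i < n, ∀ j < n, (quotCmd.exec s).arr 2 i j =
      if ∃ x < n, ∃ y < n, E x y ∧ f x = i ∧ f y = j then 1 else 0 := by
  have hc := clearCmd_spec hn
  simp only [quotCmd, exec]
  set s₁ := clearCmd.exec s with hs₁
  have hn₁ : s₁.var 0 = n := by rw [hs₁, exec_var _ _ _ (by decide), hn]
  have h0 : s₁.arr 0 = s.arr 0 := exec_arr _ _ _ (by decide)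
  have h4 : s₁.arr 4 = s.arr 4 := exec_arr _ _ _ (by decide)
  refine for_spec hn₁ (fun k s' => ∀ i < n, ∀ j < n, s'.arr 2 i j =
      if ∃ x < k, ∃ y < n, E x y ∧ f x = i ∧ f y = j then 1 else 0) (by simpa using hc) ?_
  intro k hk s' hF hx hI
  have hn' : s'.var 0 = n := by rw [hF.1 0 (by decide), hn₁]
  have h0' : s'.arr 0 = s.arr 0 := by rw [hF.2 0 (by decide), h0]
  have h4' : s'.arr 4 = s.arr 4 := by rw [hF.2 4 (by decide), h4]
  have := for_spec (x := 2) (c := .ite (.get 0 (.var 1) (.var 2))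
    (.store 2 (.get 4 (.var 1) (.const 0)) (.get 4 (.var 2) (.const 0)) (.const 1)) .skip) hn'
    (fun l s'' => ∀ i < n, ∀ j < n, s''.arr 2 i j =
      if (∃ x < k, ∃ y < n, E x y ∧ f x = i ∧ f y = j) ∨ (∃ y < l, E k y ∧ f k = i ∧ f y = j)
      then 1 else 0)
    (by simpa using hI)
    (by
      intro l hl s'' hF' hx' hJ i hi j hj
      have h1 : s''.var 1 = k := by rw [hF'.1 1 (by decide), hx]
      have h0'' : s''.arr 0 = s.arr 0 := by rw [hF'.2 0 (by decide), h0']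
      have h4'' : s''.arr 4 = s.arr 4 := by rw [hF'.2 4 (by decide), h4']
      have hstep : (∃ y < l + 1, E k y ∧ f k = i ∧ f y = j) ↔
          (∃ y < l, E k y ∧ f k = i ∧ f y = j) ∨ (E k l ∧ f k = i ∧ f l = j) := by
        constructor
        · rintro ⟨y, hy, h⟩
          rcases Nat.lt_succ_iff_lt_or_eq.1 hy with hy | rfl
          · exact Or.inl ⟨y, hy, h⟩
          · exact Or.inr h
        · rintro (⟨y, hy, h⟩ | h)
          · exact ⟨y, by omega, h⟩
          · exact ⟨l, by omega, h⟩
      simp only [hstep, exec, Expr.eval, Memory.setVar_arr, h1, hx', h0'', hE, h4'', hf k hk, hf l hl]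
      by_cases hkl : E k l
      · simp only [hkl, if_true, Memory.setArr_arr, true_and, hJ i hi j hj]
        by_cases h : i = f k ∧ j = f l
        · simp [h]
        · rw [if_neg h]
          have : ¬ (f k = i ∧ f l = j) := fun h' => h ⟨h'.1.symm, h'.2.symm⟩
          simp [this]
      · simp only [hkl, if_false, hJ i hi j hj, false_and, or_false])
  intro i hi j hj
  have h := this i hi j hj
  simp only [imageRowCmd, Memory.setVar_arr]
  rw [h]
  congr 1
  rw [eq_iff_iff]
  constructor
  · rintro (⟨x, hx, h'⟩ | h')
    · exact ⟨x, by omega, h'⟩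
    · exact ⟨k, by omega, h'⟩
  · rintro ⟨x, hx, h'⟩
    rcases Nat.lt_succ_iff_lt_or_eq.1 hx with hx | rfl
    · exact Or.inl ⟨x, hx, h'⟩
    · exact Or.inr h'

/-! ### Peeling -/

/-- `x₄ := ∑ j, A₂[x₁, j]`, the sum over all `j < x₀` with `A₅[j, 0] ≠ 0`. -/
def degCmd : Cmd :=
  .seq (.assign 4 (.const 0)) (.forLoop 2 (.ite (.get 5 (.var 2) (.const 0))
    (.assign 4 (.add (.var 4) (.get 2 (.var 1) (.var 2)))) .skip))

/-- Remove all vertices of degree at most `2` from the set `A₅`, again and again. -/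
def peelCmd : Cmd :=
  .seq (.forLoop 1 (.store 5 (.var 1) (.const 0) (.const 1)))
    (.forLoop 3 (.forLoop 1 (.seq degCmd (.ite (.sub (.var 4) (.const 2)) .skip
      (.store 5 (.var 1) (.const 0) (.const 0))))))

/-- The sum of the entries `R i j` with `j < n` and `P j ≠ 0`. -/
def rowSum (n : ℕ) (R : ℕ → ℕ → ℕ) (P : ℕ → ℕ) (i : ℕ) : ℕ :=
  ∑ j ∈ (Finset.range n).filter (fun j => P j ≠ 0), R i j

lemma degCmd_spec {s : Memory} {n : ℕ} (hn : s.var 0 = n) :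
    (degCmd.exec s).var 4 = rowSum n (s.arr 2) (fun x => s.arr 5 x 0) (s.var 1) := by
  rw [degCmd, exec, rowSum]
  refine for_spec (n := n) (by simpa [exec] using hn) (fun k s' => s'.var 4 =
    ∑ j ∈ (Finset.range k).filter (fun j => s.arr 5 j 0 ≠ 0), s.arr 2 (s.var 1) j) ?_ ?_
  · simp [exec, Expr.eval]
  intro k hk s' hF hx hI
  have h1 : s'.var 1 = s.var 1 := by rw [hF.1 1 (by decide)]; rfl
  have h2 : s'.arr 2 = s.arr 2 := by rw [hF.2 2 (by decide)]; rfl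
  have h5 : s'.arr 5 = s.arr 5 := by rw [hF.2 5 (by decide)]; rfl
  simp only [exec, Expr.eval, h1, h2, h5, hx, Finset.range_add_one, Finset.filter_insert]
  split_ifs with h
  · rw [Finset.sum_insert (by simp)]
    simp [hI, add_comm]
  · simpa using hI

/-- One step of the peeling. -/
def peelStep (n : ℕ) (R : ℕ → ℕ → ℕ) (x : ℕ) (P : ℕ → ℕ) : ℕ → ℕ :=
  if rowSum n R P x ≤ 2 then Function.update P x 0 else P

/-- The link between the memory and the pure function `peelStep`. Beyond `n` the array may hold
anything, so `P₀` is specified only below `n`. -/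
lemma peelCmd_exec {s : Memory} {n : ℕ} (hn : s.var 0 = n) :
    ∃ P₀ : ℕ → ℕ, (∀ x < n, P₀ x = 1) ∧ ∀ x, (peelCmd.exec s).arr 5 x 0 =
      sweep (fun _ => sweep (peelStep n (s.arr 2)) n) n P₀ x := by
  set s₁ := (Cmd.forLoop 1 (.store 5 (.var 1) (.const 0) (.const 1))).exec s with hs₁
  have hn₁ : s₁.var 0 = n := by rw [hs₁, exec_var _ _ _ (by decide), hn]
  have h2 : s₁.arr 2 = s.arr 2 := exec_arr _ _ _ (by decide)
  refine ⟨fun x => s₁.arr 5 x 0, ?_, ?_⟩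
  · refine for_spec hn (fun k s' => ∀ x < k, s'.arr 5 x 0 = 1) (by simp) ?_
    intro k hk s' hF hx hI x hxk
    simp only [exec, Expr.eval, Memory.setVar_arr, Memory.setArr_arr, hx, true_and, and_true]
    split_ifs with h
    · rfl
    · exact hI x (by omega)
  · rw [peelCmd, exec, ← hs₁, ← funext_iff]
    refine for_spec hn₁ (fun k s' => (fun x => s'.arr 5 x 0) =
      sweep (fun _ => sweep (peelStep n (s.arr 2)) n) k fun x => s₁.arr 5 x 0) rfl ?_
    intro k hk s' hF hx hI
    have hn' : s'.var 0 = n := by rw [hF.1 0 (by decide), hn₁]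
    have h2' : s'.arr 2 = s.arr 2 := by rw [hF.2 2 (by decide), h2]
    simp only [sweep, Memory.setVar_arr]
    rw [← hI]
    refine for_spec hn' (fun l s'' => (fun x => s''.arr 5 x 0) =
      sweep (peelStep n (s.arr 2)) l fun x => s'.arr 5 x 0) rfl ?_
    intro l hl s'' hF' hx' hI'
    have hn'' : s''.var 0 = n := by rw [hF'.1 0 (by decide), hn']
    have h2'' : s''.arr 2 = s.arr 2 := by rw [hF'.2 2 (by decide), h2']
    have hdeg := degCmd_spec hn''
    have h5 : (degCmd.exec s'').arr 5 = s''.arr 5 := exec_arr _ _ _ (by decide)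
    have h1 : (degCmd.exec s'').var 1 = l := by rw [exec_var _ _ _ (by decide), hx']
    rw [hI', h2'', hx'] at hdeg
    simp only [sweep, Memory.setVar_arr]
    rw [← hI'] at hdeg ⊢
    simp only [exec, Expr.eval, hdeg, peelStep]
    by_cases h : rowSum n (s.arr 2) (fun x => s''.arr 5 x 0) l ≤ 2
    · rw [if_neg (by omega), if_pos h]
      ext x
      simp only [Memory.setArr_arr, h1, h5, Function.update_apply]
      simp
    · rw [if_pos (by omega), if_neg h, h5]

lemma peelStep_fixed_or_lt (n : ℕ) (R : ℕ → ℕ → ℕ) (x : ℕ) (hx : x < n) (P : ℕ → ℕ) :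
    peelStep n R x P = P ∨ ((Finset.range n).filter fun j => peelStep n R x P j ≠ 0).card <
      ((Finset.range n).filter fun j => P j ≠ 0).card := by
  unfold peelStep
  split_ifs with h
  swap
  · exact Or.inl rfl
  by_cases hP : P x = 0
  · left
    rw [← hP, Function.update_eq_self]
  · right
    apply Finset.card_lt_card
    refine Finset.ssubset_iff_of_subset ?_ |>.2 ⟨x, by simp [hx, hP], by simp⟩
    intro y
    simp only [Finset.mem_filter, Function.update_apply]
    split_ifs with hy <;> simp

/-- The result of the peeling is the largest set of minimum degree at least `3`. -/
lemma peelCmd_spec {s : Memory} {n : ℕ} (hn : s.var 0 = n) :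
    (∀ x < n, (peelCmd.exec s).arr 5 x 0 ≠ 0 →
      3 ≤ rowSum n (s.arr 2) (fun x => (peelCmd.exec s).arr 5 x 0) x) ∧
    ∀ S ⊆ Finset.range n, (∀ v ∈ S, 3 ≤ ∑ j ∈ S, s.arr 2 v j) →
      ∀ v ∈ S, (peelCmd.exec s).arr 5 v 0 ≠ 0 := by
  obtain ⟨P₀, hP₀, hP⟩ := peelCmd_exec hn
  simp only [hP]
  set R := s.arr 2
  set T : (ℕ → ℕ) → ℕ → ℕ := sweep (peelStep n R) n with hT
  let μ : (ℕ → ℕ) → ℕ := fun P => ((Finset.range n).filter fun j => P j ≠ 0).card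
  have hsweep := fun P => sweep_fixed_or_lt (n := n) (μ := μ) (peelStep_fixed_or_lt n R) P
  constructor
  · have hfix := sweep_const_fixed (T := T) (μ := μ)
      (fun P => (hsweep P).imp (fun h => h.1) id) n P₀
      ((Finset.card_filter_le _ _).trans (by simp))
    set P := sweep (fun _ => T) n P₀
    intro x hx hPx
    rcases hsweep P with h | h
    · have h1 := h.2 x hx
      change 3 ≤ rowSum n R P x
      by_contra hlt
      rw [peelStep, if_pos (by omega)] at h1
      have := congrFun h1 x
      simp at this
      exact hPx this.symm
    · rw [← hT, hfix] at h
      exact absurd h (lt_irrefl _)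
  · intro S hS h3
    refine sweep_invariant (p := fun P : ℕ → ℕ => ∀ v ∈ S, P v ≠ 0) ?_ ?_
    · intro _ _ P h
      refine sweep_invariant (p := fun P : ℕ → ℕ => ∀ v ∈ S, P v ≠ 0) ?_ h
      intro x hx P h v hv
      unfold peelStep
      split_ifs with hle
      · rw [Function.update_apply]
        split_ifs with hvx
        · subst hvx
          -- As long as `S` survives, each of its vertices has degree at least `3` in the current
          -- set and is not removed.
          have := h3 v hv
          have hsub : S ⊆ (Finset.range n).filter fun j => P j ≠ 0 := fun w hw =>
            Finset.mem_filter.2 ⟨hS hw, h w hw⟩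
          have := Finset.sum_le_sum_of_subset (f := R v) hsub
          unfold rowSum at hle
          omega
        · exact h v hv
      · exact h v hv
    · intro v hv
      rw [hP₀ v (by simpa using hS hv)]
      simp

/-! ### Testing niceness -/

lemma flag_for {x : ℕ} {c : Cmd} {s : Memory} {n : ℕ} (hn : s.var 0 = n) (hx : 5 ≠ x)
    (φ : ℕ → Prop)
    (h : ∀ k < n, ∀ s', Frame (.forLoop x c) s s' → s'.var x = k →
      ((c.exec s').var 5 ≠ 0 ↔ s'.var 5 ≠ 0 ∧ φ k)) :
    ((Cmd.forLoop x c).exec s).var 5 ≠ 0 ↔ s.var 5 ≠ 0 ∧ ∀ k < n, φ k := by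
  refine for_spec hn (fun k s' => s'.var 5 ≠ 0 ↔ s.var 5 ≠ 0 ∧ ∀ l < k, φ l) ?_ ?_
  · simp [hx]
  · intro k hk s' hF hxk hI
    rw [Memory.setVar_var, if_neg hx, h k hk s' hF hxk, hI, Nat.forall_lt_succ_right, and_assoc]

/-- Clear the flag `x₅` if `A₂` has a nonzero diagonal entry. -/
def loopCheck : Cmd :=
  .forLoop 1 (.ite (.get 2 (.var 1) (.var 1)) (.assign 5 (.const 0)) .skip)

/-- Clear the flag `x₅` if some vertex in `A₅` has degree above `3` in `A₅`. -/
def degCheck : Cmd :=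
  .forLoop 1 (.ite (.get 5 (.var 1) (.const 0))
    (.seq degCmd (.ite (.sub (.var 4) (.const 3)) (.assign 5 (.const 0)) .skip)) .skip)

/-- Clear the flag `x₅` if `A₂` contains a `K₄`. -/
def cliqueCheck : Cmd :=
  .forLoop 1 (.forLoop 2 (.forLoop 3 (.forLoop 4 (.ite (.sub
    (.add (.add (.add (.get 2 (.var 1) (.var 2)) (.get 2 (.var 1) (.var 3)))
      (.add (.get 2 (.var 1) (.var 4)) (.get 2 (.var 2) (.var 3))))
      (.add (.get 2 (.var 2) (.var 4)) (.get 2 (.var 3) (.var 4)))) (.const 5))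
    (.assign 5 (.const 0)) .skip))))

/-- Set the flag `x₅` if the image of the graph under `x ↦ A₄[x, 0]` is nice. -/
def niceCmd : Cmd :=
  .seq quotCmd (.seq peelCmd (.seq (.assign 5 (.const 1))
    (.seq loopCheck (.seq degCheck cliqueCheck))))

lemma loopCheck_spec {s : Memory} {n : ℕ} (hn : s.var 0 = n) :
    (loopCheck.exec s).var 5 ≠ 0 ↔ s.var 5 ≠ 0 ∧ ∀ i < n, s.arr 2 i i = 0 := by
  refine flag_for hn (by decide) _ fun k hk s' hF hx => ?_
  have h2 : s'.arr 2 = s.arr 2 := hF.2 2 (by decide)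
  simp only [exec, Expr.eval, hx, h2]
  split_ifs with h <;> simp_all

lemma degCheck_spec {s : Memory} {n : ℕ} (hn : s.var 0 = n) :
    (degCheck.exec s).var 5 ≠ 0 ↔ s.var 5 ≠ 0 ∧ ∀ i < n, s.arr 5 i 0 ≠ 0 →
      rowSum n (s.arr 2) (fun x => s.arr 5 x 0) i ≤ 3 := by
  refine flag_for hn (by decide) _ fun k hk s' hF hx => ?_
  have h2 : s'.arr 2 = s.arr 2 := hF.2 2 (by decide)
  have h5 : s'.arr 5 = s.arr 5 := hF.2 5 (by decide)
  have hdeg := degCmd_spec (s := s') (n := n) (by rw [hF.1 0 (by decide), hn])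
  have hv5 : (degCmd.exec s').var 5 = s'.var 5 := exec_var _ _ _ (by decide)
  rw [h2, h5, hx] at hdeg
  rw [exec]
  simp only [Expr.eval, hx, h5]
  by_cases h : s.arr 5 k 0 = 0
  · simp [h, exec]
  · rw [if_pos h]
    simp only [exec, Expr.eval, hdeg]
    by_cases h3 : rowSum n (s.arr 2) (fun x => s.arr 5 x 0) k ≤ 3
    · rw [if_neg (by omega), hv5]
      simp [h3]
    · rw [if_pos (by omega)]
      simp [h3, h]

lemma cliqueCheck_spec {s : Memory} {n : ℕ} (hn : s.var 0 = n) :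
    (cliqueCheck.exec s).var 5 ≠ 0 ↔ s.var 5 ≠ 0 ∧ ∀ i < n, ∀ j < n, ∀ k < n, ∀ l < n,
      s.arr 2 i j + s.arr 2 i k + (s.arr 2 i l + s.arr 2 j k) + (s.arr 2 j l + s.arr 2 k l) ≤ 5 := by
  refine flag_for hn (by decide) _ fun i hi s₁ hF₁ hx₁ => ?_
  refine flag_for (by rw [hF₁.1 0 (by decide), hn]) (by decide) _ fun j hj s₂ hF₂ hx₂ => ?_
  refine flag_for (by rw [hF₂.1 0 (by decide), hF₁.1 0 (by decide), hn]) (by decide) _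
    fun k hk s₃ hF₃ hx₃ => ?_
  refine flag_for (by rw [hF₃.1 0 (by decide), hF₂.1 0 (by decide), hF₁.1 0 (by decide), hn])
    (by decide) _ fun l hl s₄ hF₄ hx₄ => ?_
  have h2 : s₄.arr 2 = s.arr 2 := by
    rw [hF₄.2 2 (by decide), hF₃.2 2 (by decide), hF₂.2 2 (by decide), hF₁.2 2 (by decide)]
  have h1 : s₄.var 1 = i := by
    rw [hF₄.1 1 (by decide), hF₃.1 1 (by decide), hF₂.1 1 (by decide), hx₁]
  have h2' : s₄.var 2 = j := by rw [hF₄.1 2 (by decide), hF₃.1 2 (by decide), hx₂]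
  have h3 : s₄.var 3 = k := by rw [hF₄.1 3 (by decide), hx₃]
  simp only [exec, Expr.eval, h1, h2', h3, hx₄, h2]
  split_ifs with h
  · simp only [Memory.setVar_var, if_true]
    omega
  · rw [iff_self_and]
    omega

/-- The map `f` is a proper coloring of `G`, and the image of `G` is nice. -/
def IsNice (n : ℕ) (G : SimpleGraph ℕ) (f : ℕ → ℕ) : Prop :=
  (∀ x y, G.Adj x y → f x ≠ f y) ∧ NiceOn (quotGraph G f) (Finset.range n)

open scoped Classical in
-- Every set of minimum degree at least `3` is contained in the support of `P`, and degrees grow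
-- with the set; so the cubic condition has to be checked for that support only.
lemma isNice_iff {n : ℕ} {G : SimpleGraph ℕ} (hG : ∀ x y, G.Adj x y → x < n ∧ y < n) {f : ℕ → ℕ}
    (hf : ∀ x < n, f x < n) {R : ℕ → ℕ → ℕ} {P : ℕ → ℕ}
    (hR : ∀ i < n, ∀ j < n, R i j =
      if ∃ x < n, ∃ y < n, G.Adj x y ∧ f x = i ∧ f y = j then 1 else 0)
    (hP : ∀ x < n, P x ≠ 0 → 3 ≤ rowSum n R P x)
    (hPmax : ∀ S ⊆ Finset.range n, (∀ v ∈ S, 3 ≤ ∑ j ∈ S, R v j) → ∀ v ∈ S, P v ≠ 0) :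
    ((∀ i < n, R i i = 0) ∧ (∀ i < n, P i ≠ 0 → rowSum n R P i ≤ 3) ∧
      ∀ i < n, ∀ j < n, ∀ k < n, ∀ l < n,
        R i j + R i k + (R i l + R j k) + (R j l + R k l) ≤ 5) ↔ IsNice n G f := by
  have loops : (∀ i < n, R i i = 0) ↔ ∀ x y, G.Adj x y → f x ≠ f y := by
    constructor
    · intro h x y hxy he
      have := h (f x) (hf x (hG x y hxy).1)
      rw [hR _ (hf x (hG x y hxy).1) _ (hf x (hG x y hxy).1),
        if_pos ⟨x, (hG x y hxy).1, y, (hG x y hxy).2, hxy, rfl, he.symm⟩] at this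
      exact one_ne_zero this
    · intro h i hi
      rw [hR i hi i hi, if_neg]
      rintro ⟨x, -, y, -, hxy, h1, h2⟩
      exact h x y hxy (h1.trans h2.symm)
  rw [loops, IsNice]
  refine and_congr_right fun hprop => ?_
  have hR' : ∀ i < n, ∀ j < n, R i j = if (quotGraph G f).Adj i j then 1 else 0 := by
    intro i hi j hj
    rw [hR i hi j hj]
    congr 1
    rw [eq_iff_iff]
    constructor
    · rintro ⟨x, -, y, -, hxy, rfl, rfl⟩
      exact ⟨hprop x y hxy, x, y, hxy, rfl, rfl⟩
    · rintro ⟨-, x, y, hxy, rfl, rfl⟩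
      exact ⟨x, (hG x y hxy).1, y, (hG x y hxy).2, hxy, rfl, rfl⟩
  have hsum : ∀ S ⊆ Finset.range n, ∀ v < n, ∑ j ∈ S, R v j = degIn (quotGraph G f) S v := by
    intro S hS v hv
    rw [degIn, Finset.card_filter]
    refine Finset.sum_congr rfl fun j hj => ?_
    rw [hR' v hv j (by simpa using hS hj)]
  have hPsub : ((Finset.range n).filter fun j => P j ≠ 0) ⊆ Finset.range n :=
    Finset.filter_subset _ _
  constructor
  · rintro ⟨hdeg, hK⟩
    refine ⟨?_, ?_⟩
    · intro a ha b hb c hc d hd h1 h2 h3 h4 h5 h6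
      rw [Finset.mem_range] at ha hb hc hd
      have := hK a ha b hb c hc d hd
      simp [hR' _ ha _ hb, hR' _ ha _ hc, hR' _ ha _ hd, hR' _ hb _ hc, hR' _ hb _ hd,
        hR' _ hc _ hd, h1, h2, h3, h4, h5, h6] at this
    · intro S hS h3 v hv
      have hSP : S ⊆ (Finset.range n).filter fun j => P j ≠ 0 := by
        intro w hw
        refine Finset.mem_filter.2 ⟨hS hw, hPmax S hS (fun u hu => ?_) w hw⟩
        rw [hsum S hS u (by simpa using hS hu)]
        exact h3 u hu
      refine (degIn_mono _ hSP v).trans ?_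
      have hvn : v < n := by simpa using hS hv
      rw [← hsum _ hPsub v hvn]
      exact hdeg v hvn (Finset.mem_filter.1 (hSP hv)).2
  · intro hN
    constructor
    · intro i hi hPi
      rw [rowSum, hsum _ hPsub i hi]
      refine hN.cubic _ hPsub ?_ i (by simp [hi, hPi])
      intro v hv
      simp only [Finset.mem_filter, Finset.mem_range] at hv
      rw [← hsum _ hPsub v hv.1]
      exact hP v hv.1 hv.2
    · intro i hi j hj k hk l hl
      have := hN.noK4 i (by simpa) j (by simpa) k (by simpa) l (by simpa)
      have le1 : ∀ x < n, ∀ y < n, R x y ≤ 1 := fun x hx y hy => by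
        rw [hR' x hx y hy]
        split_ifs <;> simp
      have adj : ∀ x < n, ∀ y < n, R x y = 1 → (quotGraph G f).Adj x y := fun x hx y hy h => by
        by_contra hno
        rw [hR' x hx y hy, if_neg hno] at h
        exact zero_ne_one h
      have h1 := le1 i hi j hj
      have h2 := le1 i hi k hk
      have h3 := le1 i hi l hl
      have h4 := le1 j hj k hk
      have h5 := le1 j hj l hl
      have h6 := le1 k hk l hl
      -- Six entries that are at most `1` and have sum above `5` are all equal to `1`.
      by_contra hlt
      exact this (adj i hi j hj (by omega)) (adj i hi k hk (by omega)) (adj i hi l hl (by omega))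
        (adj j hj k hk (by omega)) (adj j hj l hl (by omega)) (adj k hk l hl (by omega))

/-- The memory holds the number of vertices and the adjacency matrix. -/
structure Holds (s : Memory) (n : ℕ) (G : SimpleGraph ℕ) : Prop where
  size : s.var 0 = n
  adj : ∀ x y, s.arr 0 x y ≠ 0 ↔ G.Adj x y

lemma Holds.exec {s : Memory} {n : ℕ} {G : SimpleGraph ℕ} (h : Holds s n G) {c : Cmd}
    (h0 : 0 ∉ c.vars) (h0' : 0 ∉ c.arrs) : Holds (c.exec s) n G :=
  ⟨by rw [exec_var _ _ _ h0, h.size], by rw [exec_arr _ _ _ h0']; exact h.adj⟩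

lemma Holds.frame {s s' : Memory} {n : ℕ} {G : SimpleGraph ℕ} (h : Holds s n G) {c : Cmd}
    (hF : Frame c s s') (h0 : 0 ∉ c.vars) (h0' : 0 ∉ c.arrs) : Holds s' n G :=
  ⟨by rw [hF.1 _ h0, h.size], by rw [hF.2 _ h0']; exact h.adj⟩

lemma niceCmd_spec {s : Memory} {n : ℕ} {G : SimpleGraph ℕ} (hs : Holds s n G)
    (hG : ∀ x y, G.Adj x y → x < n ∧ y < n) {f : ℕ → ℕ} (hf : ∀ x < n, f x < n)
    (h4 : ∀ x < n, s.arr 4 x 0 = f x) :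
    (Expr.var 5).eval (niceCmd.exec s) ≠ 0 ↔ IsNice n G f := by
  classical
  change (niceCmd.exec s).var 5 ≠ 0 ↔ _
  have hquot := quotCmd_spec hs.size hs.adj h4
  have e : niceCmd.exec s = cliqueCheck.exec (degCheck.exec (loopCheck.exec
    ((peelCmd.exec (quotCmd.exec s)).setVar 5 1))) := rfl
  rw [e]
  set s₁ := quotCmd.exec s with hs₁
  have hn₁ : s₁.var 0 = n := by rw [hs₁, exec_var _ _ _ (by decide), hs.size]
  obtain ⟨hP, hPmax⟩ := peelCmd_spec hn₁
  set s₂ := peelCmd.exec s₁ with hs₂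
  have hn₂ : s₂.var 0 = n := by rw [hs₂, exec_var _ _ _ (by decide), hn₁]
  have h2 : s₂.arr 2 = s₁.arr 2 := exec_arr _ _ _ (by decide)
  have hn₃ : (loopCheck.exec (s₂.setVar 5 1)).var 0 = n := by
    rw [exec_var _ _ _ (by decide)]; exact hn₂
  have ha₃ : (loopCheck.exec (s₂.setVar 5 1)).arr = s₂.arr := by
    ext a : 1
    rw [exec_arr _ _ _ (by simp [loopCheck, arrs])]; rfl
  have hn₄ : (degCheck.exec (loopCheck.exec (s₂.setVar 5 1))).var 0 = n := by
    rw [exec_var _ _ _ (by decide), hn₃]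
  have ha₄ : (degCheck.exec (loopCheck.exec (s₂.setVar 5 1))).arr = s₂.arr := by
    ext a : 1
    rw [exec_arr _ _ _ (by simp [degCheck, degCmd, arrs]), ha₃]
  rw [cliqueCheck_spec hn₄, degCheck_spec hn₃, loopCheck_spec (n := n) (by simpa using hn₂), ha₃, ha₄,
    ← isNice_iff hG hf hquot hP hPmax]
  simp only [Memory.setVar_var, Memory.setVar_arr, if_true, h2]
  tauto

/-! ### Identifying classes -/

/-- Merge the class `b` into the class `a`. -/
def mergeMap (n a b : ℕ) (f : ℕ → ℕ) (x : ℕ) : ℕ := if x < n ∧ f x = b then a else f x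

open scoped Classical in
/-- Merge the class `b` into the class `a` if the result is nice. -/
noncomputable def mergeStep (n : ℕ) (G : SimpleGraph ℕ) (a b : ℕ) (f : ℕ → ℕ) : ℕ → ℕ :=
  if f a = a ∧ IsNice n G (mergeMap n a b f) then mergeMap n a b f else f

/-- Try to merge all pairs of classes. -/
noncomputable def mergeRound (n : ℕ) (G : SimpleGraph ℕ) : (ℕ → ℕ) → ℕ → ℕ :=
  sweep (fun a => sweep (fun b => mergeStep n G a b) n) n

/-- A nice partition of `{0, …, n - 1}`, given by representatives. -/
structure IsNicePartition (n : ℕ) (G : SimpleGraph ℕ) (f : ℕ → ℕ) : Prop where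
  lt : ∀ x < n, f x < n
  idem : ∀ x < n, f (f x) = f x
  nice : IsNice n G f

lemma mergeMap_lt {n a b : ℕ} {f : ℕ → ℕ} (ha : a < n) (hf : ∀ x < n, f x < n) :
    ∀ x < n, mergeMap n a b f x < n := by
  intro x hx
  unfold mergeMap
  split_ifs
  · exact ha
  · exact hf x hx

lemma IsNicePartition.mergeStep {n : ℕ} {G : SimpleGraph ℕ} {f : ℕ → ℕ}
    (h : IsNicePartition n G f) {a : ℕ} (ha : a < n) (b : ℕ) :
    IsNicePartition n G (mergeStep n G a b f) := by
  unfold SparseColoring.mergeStep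
  split_ifs with hc
  · refine ⟨mergeMap_lt ha h.lt, ?_, hc.2⟩
    intro x hx
    have h1 := h.idem x hx
    have h2 := hc.1
    unfold mergeMap
    grind
  · exact h

lemma IsNicePartition.mergeRound {n : ℕ} {G : SimpleGraph ℕ} {f : ℕ → ℕ}
    (h : IsNicePartition n G f) : IsNicePartition n G (mergeRound n G f) :=
  sweep_invariant (fun _ ha _ h => sweep_invariant (fun b _ _ h => h.mergeStep ha b) h) h

lemma mergeStep_fixed_or_lt {n : ℕ} {G : SimpleGraph ℕ} {a : ℕ} (ha : a < n) (b : ℕ)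
    (f : ℕ → ℕ) :
    mergeStep n G a b f = f ∨ ((Finset.range n).image (mergeStep n G a b f)).card <
      ((Finset.range n).image f).card := by
  unfold mergeStep
  split_ifs with hc
  swap
  · exact Or.inl rfl
  by_cases hb : a ≠ b ∧ ∃ x < n, f x = b
  · right
    obtain ⟨hab, x, hx, hxb⟩ := hb
    apply Finset.card_lt_card
    refine (Finset.ssubset_iff_of_subset ?_).2 ⟨b, ?_, ?_⟩
    · intro y hy
      simp only [Finset.mem_image, Finset.mem_range, mergeMap] at hy ⊢
      obtain ⟨z, hz, rfl⟩ := hy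
      split_ifs
      -- As `a` represents itself, merging into it creates no new class.
      · exact ⟨a, ha, hc.1⟩
      · exact ⟨z, hz, rfl⟩
    · exact Finset.mem_image.2 ⟨x, by simpa using hx, hxb⟩
    · simp only [Finset.mem_image, Finset.mem_range, mergeMap, not_exists, not_and]
      intro z hz
      split_ifs with h
      · exact hab
      · exact fun h' => h ⟨hz, h'⟩
  -- Nothing below `n` moves, and `mergeMap` changes nothing beyond `n`, so this is an equality of
  -- functions on all of `ℕ`.
  · left
    ext x
    unfold mergeMap
    grind

lemma mergeRound_fixed_or_lt (n : ℕ) (G : SimpleGraph ℕ) (f : ℕ → ℕ) :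
    (mergeRound n G f = f ∧ ∀ a < n, ∀ b < n, mergeStep n G a b f = f) ∨
      ((Finset.range n).image (mergeRound n G f)).card < ((Finset.range n).image f).card := by
  have inner : ∀ a < n, ∀ f, (sweep (fun b => mergeStep n G a b) n f = f ∧
      ∀ b < n, mergeStep n G a b f = f) ∨
      ((Finset.range n).image (sweep (fun b => mergeStep n G a b) n f)).card <
        ((Finset.range n).image f).card := fun a ha f =>
    sweep_fixed_or_lt (μ := fun f => ((Finset.range n).image f).card)
      (fun b _ f => mergeStep_fixed_or_lt ha b f) f
  rcases sweep_fixed_or_lt (n := n) (μ := fun f : ℕ → ℕ => ((Finset.range n).image f).card)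
    (fun a ha f => (inner a ha f).imp_left And.left) f with h | h
  · refine Or.inl ⟨h.1, fun a ha => ?_⟩
    rcases inner a ha f with h' | h'
    · exact h'.2
    · rw [h.2 a ha] at h'
      exact absurd h' (lt_irrefl _)
  · exact Or.inr h

/-- A nice partition that admits no further merging has at most three classes. -/
lemma IsNicePartition.card_le_three {n : ℕ} {G : SimpleGraph ℕ} {f : ℕ → ℕ}
    (h : IsNicePartition n G f) (hG : ∀ x y, G.Adj x y → x < n ∧ y < n)
    (hfix : ∀ a < n, ∀ b < n, SparseColoring.mergeStep n G a b f = f) :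
    ((Finset.range n).image f).card ≤ 3 := by
  by_contra hcard
  set U := (Finset.range n).image f with hU
  have hUn : U ⊆ Finset.range n := by
    intro y hy
    obtain ⟨x, hx, rfl⟩ := Finset.mem_image.1 hy
    simpa using h.lt x (by simpa using hx)
  obtain ⟨hprop, hnice⟩ := h.nice
  obtain ⟨a, ha, b, hb, hne, hab, hglue⟩ :=
    exists_glue U.card U rfl (by omega) (hnice.mono hUn)
  have hquot : quotGraph G (mergeMap n a b f) = quotGraph (quotGraph G f) (glue a b) := by
    rw [← quotGraph_comp G f _ hprop]
    ext i j
    refine and_congr_right fun _ => ⟨?_, ?_⟩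
    · rintro ⟨x, y, hxy, rfl, rfl⟩
      exact ⟨x, y, hxy, by simp [mergeMap, glue, hG x y hxy], by simp [mergeMap, glue, hG x y hxy]⟩
    · rintro ⟨x, y, hxy, rfl, rfl⟩
      exact ⟨x, y, hxy, by simp [mergeMap, glue, hG x y hxy], by simp [mergeMap, glue, hG x y hxy]⟩
  -- Vertices other than the representatives are isolated, so niceness extends from `U` to the whole
  -- range.
  have hsupp : ∀ i j, (quotGraph (quotGraph G f) (glue a b)).Adj i j → i ∈ U := by
    rintro i j ⟨-, p, q, ⟨-, x, y, hxy, rfl, rfl⟩, rfl, -⟩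
    unfold glue
    split_ifs
    · exact ha
    · exact Finset.mem_image_of_mem f (by simpa using (hG x y hxy).1)
  have hmerge : IsNice n G (mergeMap n a b f) := by
    refine ⟨?_, ?_⟩
    · intro x y hxy he
      have hx := (hG x y hxy).1
      have hy := (hG x y hxy).2
      have hne := hprop x y hxy
      -- A monochromatic edge after merging would join the classes `a` and `b`, which are
      -- nonadjacent in the quotient.
      have h1 : ¬ (f x = a ∧ f y = b) := fun h' => hab ⟨‹a ≠ b›, x, y, hxy, h'.1, h'.2⟩
      have h2 : ¬ (f y = a ∧ f x = b) := fun h' => hab ⟨‹a ≠ b›, y, x, hxy.symm, h'.1, h'.2⟩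
      unfold mergeMap at he
      grind
    · rw [hquot]
      refine ⟨?_, ?_⟩
      · intro p _ q _ r _ s _ h1 h2 h3 h4 h5 h6
        exact hglue.noK4 p (hsupp _ _ h1) q (hsupp _ _ h1.symm) r (hsupp _ _ h2.symm)
          s (hsupp _ _ h3.symm) h1 h2 h3 h4 h5 h6
      · intro S _ h3
        classical
        refine hglue.cubic S ?_ h3
        intro v hv
        have := h3 v hv
        unfold degIn at this
        obtain ⟨w, hw⟩ := Finset.card_pos.1 (zero_lt_three.trans_le this)
        exact hsupp v w (Finset.mem_filter.1 hw).2
  obtain ⟨x, hx, hxa⟩ := Finset.mem_image.1 ha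
  obtain ⟨y, hy, hyb⟩ := Finset.mem_image.1 hb
  rw [Finset.mem_range] at hx hy
  have hfa : f a = a := by rw [← hxa, h.idem x hx]
  have := hfix a (by simpa using hUn ha) b (by simpa using hUn hb)
  rw [SparseColoring.mergeStep, if_pos ⟨hfa, hmerge⟩] at this
  have := congrFun this y
  rw [mergeMap, if_pos ⟨hy, hyb⟩, hyb] at this
  exact hne this

/-- There are at most `n` classes at the start and every round that changes something loses one, so
`n` rounds reach a fixed point. -/
lemma sweep_mergeRound {n : ℕ} {G : SimpleGraph ℕ} (hG : ∀ x y, G.Adj x y → x < n ∧ y < n)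
    {f : ℕ → ℕ} (h : IsNicePartition n G f) :
    IsNicePartition n G (sweep (fun _ => mergeRound n G) n f) ∧
      ((Finset.range n).image (sweep (fun _ => mergeRound n G) n f)).card ≤ 3 := by
  have hinv : IsNicePartition n G (sweep (fun _ => mergeRound n G) n f) :=
    sweep_invariant (fun _ _ _ h => h.mergeRound) h
  refine ⟨hinv, hinv.card_le_three hG ?_⟩
  have hfix := sweep_const_fixed (T := mergeRound n G)
    (μ := fun f => ((Finset.range n).image f).card)
    (fun f => (mergeRound_fixed_or_lt n G f).imp_left And.left) n f
    (Finset.card_image_le.trans (by simp))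
  rcases mergeRound_fixed_or_lt n G (sweep (fun _ => mergeRound n G) n f) with h' | h'
  · exact h'.2
  · rw [hfix] at h'
    exact absurd h' (lt_irrefl _)

/-! ### The program -/

lemma Cmd.exec_ite_pos {e : Expr} {c₁ c₂ : Cmd} {s : Memory} (h : e.eval s ≠ 0) :
    (Cmd.ite e c₁ c₂).exec s = c₁.exec s := by
  rw [exec, if_pos h]

lemma Cmd.exec_ite_neg {e : Expr} {c₁ c₂ : Cmd} {s : Memory} (h : ¬ e.eval s ≠ 0) :
    (Cmd.ite e c₁ c₂).exec s = c₂.exec s := by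
  rw [exec, if_neg h]

/-- The value is `1` if the values of `e₁` and `e₂` agree, and `0` otherwise. -/
def eqExpr (e₁ e₂ : Expr) : Expr := .sub (.const 1) (.add (.sub e₁ e₂) (.sub e₂ e₁))

lemma eqExpr_eval (e₁ e₂ : Expr) (s : Memory) :
    (eqExpr e₁ e₂).eval s ≠ 0 ↔ e₁.eval s = e₂.eval s := by
  simp only [eqExpr, Expr.eval]
  omega

/-- `A₄` becomes `A₃` with the class `x₉` merged into the class `x₈`. -/
def copyMergeCmd : Cmd :=
  .forLoop 1 (.ite (eqExpr (.get 3 (.var 1) (.const 0)) (.var 9))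
    (.store 4 (.var 1) (.const 0) (.var 8))
    (.store 4 (.var 1) (.const 0) (.get 3 (.var 1) (.const 0))))

/-- `A₃ := A₄`. -/
def commitCmd : Cmd := .forLoop 1 (.store 3 (.var 1) (.const 0) (.get 4 (.var 1) (.const 0)))

/-- Merge the class `x₉` into the class `x₈` if the result is nice. -/
def mergeCmd : Cmd :=
  .ite (eqExpr (.get 3 (.var 8) (.const 0)) (.var 8))
    (.seq copyMergeCmd (.seq niceCmd (.ite (.var 5) commitCmd .skip))) .skip

/-- Try to merge all pairs of classes, `x₀` times. -/
def roundsCmd : Cmd := .forLoop 7 (.forLoop 8 (.forLoop 9 mergeCmd))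

/-- Number the classes in `A₆`. -/
def numberCmd : Cmd :=
  .seq (.assign 4 (.const 0)) (.forLoop 1 (.ite (eqExpr (.get 3 (.var 1) (.const 0)) (.var 1))
    (.seq (.store 6 (.var 1) (.const 0) (.var 4)) (.assign 4 (.add (.var 4) (.const 1)))) .skip))

/-- Write the number of the class of each vertex to `A₁`. -/
def colorCmd : Cmd :=
  .forLoop 1 (.store 1 (.var 1) (.const 0) (.get 6 (.get 3 (.var 1) (.const 0)) (.const 0)))

/-- `A₃` and `A₄` become the partition into singletons. -/
def initCmd : Cmd :=
  .forLoop 1 (.seq (.store 3 (.var 1) (.const 0) (.var 1)) (.store 4 (.var 1) (.const 0) (.var 1)))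

/-- The coloring algorithm, with the decision in `x₆`. -/
def mainCmd : Cmd :=
  .seq initCmd (.seq niceCmd (.ite (.var 5)
    (.seq roundsCmd (.seq numberCmd (.seq colorCmd (.assign 6 (.const 1)))))
    (.assign 6 (.const 0))))

lemma copyMergeCmd_spec {s : Memory} {n : ℕ} (hn : s.var 0 = n) {f : ℕ → ℕ}
    (hf : ∀ x < n, s.arr 3 x 0 = f x) :
    ∀ x < n, (copyMergeCmd.exec s).arr 4 x 0 = mergeMap n (s.var 8) (s.var 9) f x := by
  refine for_spec hn
    (fun k s' => ∀ x < k, s'.arr 4 x 0 = mergeMap n (s.var 8) (s.var 9) f x) (by simp) ?_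
  intro k hk s' hF hx hI y hy
  have h3 : s'.arr 3 = s.arr 3 := hF.2 3 (by decide)
  have h8 : s'.var 8 = s.var 8 := hF.1 8 (by decide)
  have h9 : s'.var 9 = s.var 9 := hF.1 9 (by decide)
  simp only [Memory.setVar_arr, exec, eqExpr_eval]
  simp only [Expr.eval, h3, hx, h8, h9, hf k hk]
  rcases Nat.lt_succ_iff_lt_or_eq.1 hy with hlt | rfl
  · rw [← hI y hlt]
    split_ifs <;> simp [hlt.ne]
  · simp only [mergeMap, hk, true_and]
    split_ifs <;> simp

lemma commitCmd_spec {s : Memory} {n : ℕ} (hn : s.var 0 = n) :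
    ∀ x < n, (commitCmd.exec s).arr 3 x 0 = s.arr 4 x 0 := by
  refine for_spec hn (fun k s' => ∀ x < k, s'.arr 3 x 0 = s.arr 4 x 0) (by simp) ?_
  intro k hk s' hF hx hI y hy
  have h4 : s'.arr 4 = s.arr 4 := hF.2 4 (by decide)
  simp only [Memory.setVar_arr, exec, Memory.setArr_arr, Expr.eval, hx, h4]
  by_cases h : y = k
  · simp [h]
  · simpa [h] using hI y (by omega)

lemma mergeCmd_spec {s : Memory} {n : ℕ} {G : SimpleGraph ℕ} (hs : Holds s n G)
    (hG : ∀ x y, G.Adj x y → x < n ∧ y < n) {f : ℕ → ℕ} (hf : ∀ x < n, f x < n)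
    (h3 : ∀ x < n, s.arr 3 x 0 = f x) (ha : s.var 8 < n) :
    ∀ x < n, (mergeCmd.exec s).arr 3 x 0 = mergeStep n G (s.var 8) (s.var 9) f x := by
  intro x hx
  have htest : (eqExpr (.get 3 (.var 8) (.const 0)) (.var 8)).eval s ≠ 0 ↔
      f (s.var 8) = s.var 8 := by
    rw [eqExpr_eval, ← h3 _ ha]
    rfl
  rw [mergeCmd, mergeStep]
  by_cases hfa : f (s.var 8) = s.var 8
  swap
  · rw [exec_ite_neg (fun h => hfa (htest.1 h)), exec, if_neg (fun h => hfa h.1), h3 x hx]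
  have hcopy := copyMergeCmd_spec hs.size h3
  have hs₁ : Holds (copyMergeCmd.exec s) n G := hs.exec (by decide) (by decide)
  have hs₂ : Holds (niceCmd.exec (copyMergeCmd.exec s)) n G := hs₁.exec (by decide) (by decide)
  have hnice := niceCmd_spec hs₁ hG (mergeMap_lt ha hf) hcopy
  have h4' : (niceCmd.exec (copyMergeCmd.exec s)).arr 4 = (copyMergeCmd.exec s).arr 4 :=
    exec_arr _ _ _ (by decide)
  have h3' : (niceCmd.exec (copyMergeCmd.exec s)).arr 3 = s.arr 3 := by
    rw [exec_arr _ _ _ (by decide), exec_arr _ _ _ (by decide)]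
  rw [exec_ite_pos (htest.2 hfa), exec, exec]
  by_cases h : IsNice n G (mergeMap n (s.var 8) (s.var 9) f)
  · rw [exec_ite_pos (hnice.2 h), if_pos ⟨hfa, h⟩, commitCmd_spec hs₂.size x hx, h4', hcopy x hx]
  · rw [exec_ite_neg (fun h' => h (hnice.1 h')), exec, if_neg (fun h' => h h'.2), h3', h3 x hx]

lemma roundsCmd_spec {s : Memory} {n : ℕ} {G : SimpleGraph ℕ} (hs : Holds s n G)
    (hG : ∀ x y, G.Adj x y → x < n ∧ y < n) {f : ℕ → ℕ} (hf : IsNicePartition n G f)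
    (h3 : ∀ x < n, s.arr 3 x 0 = f x) :
    ∀ x < n, (roundsCmd.exec s).arr 3 x 0 = sweep (fun _ => mergeRound n G) n f x := by
  have hinv : ∀ k, IsNicePartition n G (sweep (fun _ => mergeRound n G) k f) := fun k =>
    sweep_invariant (fun _ _ _ h => h.mergeRound) hf
  refine for_spec hs.size (fun k s' => ∀ x < n, s'.arr 3 x 0 =
    sweep (fun _ => mergeRound n G) k f x) h3 ?_
  intro k hk s₁ hF₁ hx₁ hI₁
  have hs₁ := hs.frame hF₁ (by decide) (by decide)
  simp only [sweep, Memory.setVar_arr]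
  have hf₁ := hinv k
  set f₁ := sweep (fun _ => mergeRound n G) k f
  -- The intermediate partitions are nice too; `mergeCmd_spec` needs their representatives to be
  -- below `n`.
  have hinv₁ : ∀ a ≤ n, IsNicePartition n G
      (sweep (fun a => sweep (fun b => mergeStep n G a b) n) a f₁) := fun a ha =>
    sweep_invariant (fun _ hl _ h => sweep_invariant
      (fun b _ _ h => h.mergeStep (by omega) b) h) hf₁
  refine for_spec hs₁.size (fun a s' => ∀ x < n, s'.arr 3 x 0 =
    sweep (fun a => sweep (fun b => mergeStep n G a b) n) a f₁ x) hI₁ ?_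
  intro a ha s₂ hF₂ hx₂ hI₂
  have hs₂ := hs₁.frame hF₂ (by decide) (by decide)
  simp only [sweep, Memory.setVar_arr]
  have hf₂ := hinv₁ a ha.le
  set f₂ := sweep (fun a => sweep (fun b => mergeStep n G a b) n) a f₁
  refine for_spec hs₂.size (fun b s' => ∀ x < n, s'.arr 3 x 0 =
    sweep (fun b => mergeStep n G a b) b f₂ x) hI₂ ?_
  intro b hb s₃ hF₃ hx₃ hI₃
  have hs₃ := hs₂.frame hF₃ (by decide) (by decide)
  have h8 : s₃.var 8 = a := by rw [hF₃.1 8 (by decide), hx₂]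
  have hf₃ : IsNicePartition n G (sweep (fun b => mergeStep n G a b) b f₂) :=
    sweep_invariant (fun b _ _ h => h.mergeStep ha b) hf₂
  have := mergeCmd_spec hs₃ hG hf₃.lt hI₃ (by omega)
  rw [h8, hx₃] at this
  exact this

/-- The number of classes with a representative below `i`. -/
def classNumber (f : ℕ → ℕ) (i : ℕ) : ℕ := ((Finset.range i).filter fun j => f j = j).card

lemma classNumber_succ (f : ℕ → ℕ) (i : ℕ) :
    classNumber f (i + 1) = if f i = i then classNumber f i + 1 else classNumber f i := by
  simp only [classNumber, Finset.range_add_one, Finset.filter_insert]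
  split_ifs
  · rw [Finset.card_insert_of_notMem (by simp)]
  · rfl

lemma classNumber_lt {f : ℕ → ℕ} {i j : ℕ} (hi : f i = i) (hij : i < j) :
    classNumber f i < classNumber f j := by
  apply Finset.card_lt_card
  refine (Finset.ssubset_iff_of_subset ?_).2 ⟨i, by simp [hi, hij], by simp⟩
  exact Finset.filter_subset_filter _ (Finset.range_mono hij.le)

lemma numberCmd_spec {s : Memory} {n : ℕ} (hn : s.var 0 = n) {f : ℕ → ℕ}
    (h3 : ∀ x < n, s.arr 3 x 0 = f x) :
    ∀ i < n, f i = i → (numberCmd.exec s).arr 6 i 0 = classNumber f i := by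
  rw [numberCmd, exec]
  have := for_spec (x := 1) (c := .ite (eqExpr (.get 3 (.var 1) (.const 0)) (.var 1))
      (.seq (.store 6 (.var 1) (.const 0) (.var 4)) (.assign 4 (.add (.var 4) (.const 1)))) .skip)
    (s := (Cmd.assign 4 (.const 0)).exec s) (n := n) (by simpa [exec] using hn)
    (fun k s' => s'.var 4 = classNumber f k ∧
      ∀ i < k, f i = i → s'.arr 6 i 0 = classNumber f i)
    (by simp [exec, Expr.eval, classNumber])
    (by
      intro k hk s' hF hx hI
      have h3' : s'.arr 3 = s.arr 3 := by rw [hF.2 3 (by decide)]; rfl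
      simp only [Memory.setVar_arr, exec, eqExpr_eval]
      simp only [Expr.eval, h3', hx, h3 k hk, classNumber_succ]
      by_cases hfk : f k = k
      · simp only [hfk, if_true, Memory.setVar_var, Memory.setVar_arr, Memory.setArr_arr,
          Memory.setArr_var, hI.1]
        refine ⟨by simp, fun i hi hfi => ?_⟩
        by_cases hik : i = k
        · simp [hik]
        · simpa [hik] using hI.2 i (by omega) hfi
      · simp only [hfk, if_false, Memory.setVar_var]
        refine ⟨by simpa using hI.1, fun i hi hfi => hI.2 i ?_ hfi⟩
        rcases Nat.lt_succ_iff_lt_or_eq.1 hi with h | rfl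
        · exact h
        · exact absurd hfi hfk)
  exact this.2

lemma colorCmd_spec {s : Memory} {n : ℕ} (hn : s.var 0 = n) :
    ∀ x < n, (colorCmd.exec s).arr 1 x 0 = s.arr 6 (s.arr 3 x 0) 0 := by
  refine for_spec hn (fun k s' => ∀ x < k, s'.arr 1 x 0 = s.arr 6 (s.arr 3 x 0) 0) (by simp) ?_
  intro k hk s' hF hx hI y hy
  have h3 : s'.arr 3 = s.arr 3 := hF.2 3 (by decide)
  have h6 : s'.arr 6 = s.arr 6 := hF.2 6 (by decide)
  simp only [Memory.setVar_arr, exec, Memory.setArr_arr, Expr.eval, hx, h3, h6]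
  by_cases h : y = k
  · simp [h]
  · simpa [h] using hI y (by omega)

lemma initCmd_spec {s : Memory} {n : ℕ} (hn : s.var 0 = n) :
    ∀ x < n, (initCmd.exec s).arr 3 x 0 = x ∧ (initCmd.exec s).arr 4 x 0 = x := by
  refine for_spec hn (fun k s' => ∀ x < k, s'.arr 3 x 0 = x ∧ s'.arr 4 x 0 = x) (by simp) ?_
  intro k hk s' hF hx hI y hy
  simp only [Memory.setVar_arr, exec, Memory.setArr_arr, Memory.setArr_var, Expr.eval, hx]
  by_cases h : y = k
  · simp [h]
  · simpa [h] using hI y (by omega)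

/-- No sparsity is needed here: a positive answer always comes with a proper coloring, and a
negative one says only that the graph is not nice. -/
lemma mainCmd_spec {s : Memory} {n : ℕ} {G : SimpleGraph ℕ} (hs : Holds s n G)
    (hG : ∀ x y, G.Adj x y → x < n ∧ y < n) :
    (¬ IsNice n G id ∧ (mainCmd.exec s).var 6 = 0) ∨
      (IsNice n G id ∧ (mainCmd.exec s).var 6 = 1 ∧
        (∀ x < n, (mainCmd.exec s).arr 1 x 0 < 3) ∧
        ∀ x y, G.Adj x y → (mainCmd.exec s).arr 1 x 0 ≠ (mainCmd.exec s).arr 1 y 0) := by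
  have hinit := initCmd_spec hs.size
  have hs₁ : Holds (initCmd.exec s) n G := hs.exec (by decide) (by decide)
  have hs₂ : Holds (niceCmd.exec (initCmd.exec s)) n G := hs₁.exec (by decide) (by decide)
  have hnice := niceCmd_spec hs₁ hG (f := id) (fun x hx => hx) fun x hx => (hinit x hx).2
  have h3 : ∀ x < n, (niceCmd.exec (initCmd.exec s)).arr 3 x 0 = id x := fun x hx => by
    rw [exec_arr _ _ _ (by decide)]
    exact (hinit x hx).1
  rw [mainCmd, exec, exec]
  by_cases h : IsNice n G id
  swap
  · left
    rw [exec_ite_neg (fun h' => h (hnice.1 h'))]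
    exact ⟨h, rfl⟩
  right
  rw [exec_ite_pos (hnice.2 h), exec, exec, exec]
  simp only [show ∀ t, (Cmd.assign 6 (.const 1)).exec t = t.setVar 6 1 from fun _ => rfl,
    Memory.setVar_arr, Memory.setVar_var, if_true]
  have hpart : IsNicePartition n G id := ⟨fun x hx => hx, fun x _ => rfl, h⟩
  have hrounds := roundsCmd_spec hs₂ hG hpart h3
  obtain ⟨hf, hcard⟩ := sweep_mergeRound hG hpart
  set f := sweep (fun _ => mergeRound n G) n id
  set s₃ := roundsCmd.exec (niceCmd.exec (initCmd.exec s)) with h_s₃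
  have hs₃ : Holds s₃ n G := hs₂.exec (by decide) (by decide)
  have hs₄ : Holds (numberCmd.exec s₃) n G := hs₃.exec (by decide) (by decide)
  have h3₄ : (numberCmd.exec s₃).arr 3 = s₃.arr 3 := exec_arr _ _ _ (by decide)
  have hcol : ∀ x < n, (colorCmd.exec (numberCmd.exec s₃)).arr 1 x 0 = classNumber f (f x) := by
    intro x hx
    rw [colorCmd_spec hs₄.size x hx, h3₄, hrounds x hx,
      numberCmd_spec hs₃.size hrounds (f x) (hf.lt x hx) (hf.idem x hx)]
  refine ⟨h, trivial, fun x hx => ?_, fun x y hxy => ?_⟩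
  · rw [hcol x hx]
    -- The color of a class is the number of smaller representatives, hence less than the number of
    -- classes.
    refine (classNumber_lt (hf.idem x hx) (hf.lt x hx)).trans_le (le_trans ?_ hcard)
    apply Finset.card_le_card
    intro j hj
    rw [Finset.mem_filter] at hj
    exact Finset.mem_image.2 ⟨j, hj.1, hj.2⟩
  · obtain ⟨hx, hy⟩ := hG x y hxy
    rw [hcol x hx, hcol y hy]
    rcases lt_or_gt_of_ne (hf.nice.1 x y hxy) with hlt | hlt
    · exact (classNumber_lt (hf.idem x hx) hlt).ne
    · exact (classNumber_lt (hf.idem y hy) hlt).ne'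

/-! ### Three-sparse classes -/

lemma mainCmd_wellFormed : mainCmd.WellFormed := by
  simp [mainCmd, initCmd, niceCmd, quotCmd, clearCmd, imageRowCmd, peelCmd, degCmd, loopCheck,
    degCheck, cliqueCheck, roundsCmd, mergeCmd, copyMergeCmd, commitCmd, numberCmd, colorCmd,
    WellFormed, vars]

/-- The graph `Q` on the natural numbers. -/
def natGraph (Q : FinGraph) : SimpleGraph ℕ := quotGraph Q.2 Fin.val

lemma natGraph_adj (Q : FinGraph) (x y : Fin Q.1) :
    (natGraph Q).Adj x y ↔ Q.2.Adj x y := by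
  constructor
  · rintro ⟨-, a, b, hab, h1, h2⟩
    rwa [← Fin.ext h1, ← Fin.ext h2]
  · intro h
    exact ⟨fun e => h.ne (Fin.ext e), x, y, h, rfl, rfl⟩

lemma natGraph_lt (Q : FinGraph) (x y : ℕ) (h : (natGraph Q).Adj x y) : x < Q.1 ∧ y < Q.1 := by
  obtain ⟨-, a, b, -, rfl, rfl⟩ := h
  exact ⟨a.2, b.2⟩

lemma quotGraph_id {V : Type*} (G : SimpleGraph V) : quotGraph G id = G := by
  ext x y
  constructor
  · rintro ⟨-, a, b, hab, rfl, rfl⟩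
    exact hab
  · intro h
    exact ⟨h.ne, x, y, h, rfl, rfl⟩

lemma holds_inputMemory (Q : FinGraph) : Holds (inputMemory Q) Q.1 (natGraph Q) := by
  refine ⟨by simp [inputMemory], fun x y => ?_⟩
  simp only [inputMemory, true_and, ne_eq, ite_eq_right_iff, one_ne_zero, imp_false, not_not]
  constructor
  · rintro ⟨hx, hy, h⟩
    exact (natGraph_adj Q ⟨x, hx⟩ ⟨y, hy⟩).2 h
  · intro h
    obtain ⟨hx, hy⟩ := natGraph_lt Q x y h
    exact ⟨hx, hy, (natGraph_adj Q ⟨x, hx⟩ ⟨y, hy⟩).1 h⟩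

/-- If no subgraph has average degree above `3`, then subgraphs of minimum degree at least `3` are
`3`-regular. -/
lemma degIn_le_three_of_avgDegree {n : ℕ} {G : SimpleGraph (Fin n)}
    (hG : ∀ H : G.Subgraph, avgDegree H ≤ 3) (S : Finset (Fin n))
    (h3 : ∀ v ∈ S, 3 ≤ degIn G S v) : ∀ v ∈ S, degIn G S v ≤ 3 := by
  classical
  let H : G.Subgraph := (⊤ : G.Subgraph).induce S
  have hadj : ∀ x y, H.Adj x y ↔ x ∈ S ∧ y ∈ S ∧ G.Adj x y := fun x y => by
    simp [H]
  have hdeg : ∀ v, H.spanningCoe.degree v = if v ∈ S then degIn G S v else 0 := by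
    intro v
    rw [← SimpleGraph.card_neighborFinset_eq_degree]
    split_ifs with hv
    · rw [degIn]
      congr 1
      ext w
      simp [hadj, hv]
    · rw [Finset.card_eq_zero]
      ext w
      simp [hadj, hv]
  have hsum := H.spanningCoe.sum_degrees_eq_twice_card_edges
  simp only [hdeg, Finset.sum_ite_mem, Finset.univ_inter] at hsum
  have hedges : H.edgeSet.ncard = H.spanningCoe.edgeFinset.card := by
    rw [← Set.ncard_coe_finset, SimpleGraph.coe_edgeFinset, SimpleGraph.Subgraph.edgeSet_spanningCoe]
  have hverts : H.verts.ncard = S.card := by simp [H]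
  have havg := hG H
  intro v hv
  have hpos : 0 < S.card := Finset.card_pos.2 ⟨v, hv⟩
  rw [avgDegree, hedges, hverts, div_le_iff₀ (by exact_mod_cast hpos)] at havg
  have havg' : 2 * H.spanningCoe.edgeFinset.card ≤ 3 * S.card := by exact_mod_cast havg
  by_contra hlt
  -- A vertex of degree above `3` would push the degree sum, twice the number of edges, above `3 *
  -- S.card`.
  have : ∑ v ∈ S, 3 < ∑ v ∈ S, degIn G S v := Finset.sum_lt_sum h3 ⟨v, hv, by omega⟩
  rw [Finset.sum_const, smul_eq_mul] at this
  omega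

lemma not_colorable_of_clique {V : Type*} {G : SimpleGraph V} {a b c d : V} (hab : G.Adj a b)
    (hac : G.Adj a c) (had : G.Adj a d) (hbc : G.Adj b c) (hbd : G.Adj b d) (hcd : G.Adj c d) :
    ¬ G.Colorable 3 := by
  rintro ⟨f⟩
  have h1 := f.valid hab
  have h2 := f.valid hac
  have h3 := f.valid had
  have h4 := f.valid hbc
  have h5 := f.valid hbd
  have h6 := f.valid hcd
  omega

/-- Sparsity yields the cubic condition and the identity is always proper, so only a K₄ can prevent
niceness. -/
lemma not_colorable_of_not_isNice {Q : FinGraph} (hQ : ∀ H : Q.2.Subgraph, avgDegree H ≤ 3)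
    (h : ¬ IsNice Q.1 (natGraph Q) id) : ¬ Q.2.Colorable 3 := by
  classical
  intro hcol
  refine h ⟨fun x y hxy => hxy.ne, ?_⟩
  rw [quotGraph_id]
  refine ⟨?_, ?_⟩
  · intro a ha b hb c hc d hd hab hac had hbc hbd hcd
    rw [Finset.mem_range] at ha hb hc hd
    lift a to Fin Q.1 using ha
    lift b to Fin Q.1 using hb
    lift c to Fin Q.1 using hc
    lift d to Fin Q.1 using hd
    rw [natGraph_adj] at *
    exact not_colorable_of_clique hab hac had hbc hbd hcd hcol
  · intro S hS
    obtain ⟨S, rfl⟩ : ∃ S' : Finset (Fin Q.1), S = S'.map Fin.valEmbedding := by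
      refine ⟨Finset.univ.filter fun x => (x : ℕ) ∈ S, ?_⟩
      ext x
      simp only [Finset.mem_map, Finset.mem_filter, Finset.mem_univ, true_and, Fin.valEmbedding_apply]
      constructor
      · intro hx
        exact ⟨⟨x, by simpa using hS hx⟩, hx, rfl⟩
      · rintro ⟨y, hy, rfl⟩
        exact hy
    have hdeg : ∀ v : Fin Q.1, degIn (natGraph Q) (S.map Fin.valEmbedding) v = degIn Q.2 S v := by
      intro v
      rw [degIn, degIn, Finset.filter_map, Finset.card_map]
      congr 1
      ext w
      simp [natGraph_adj]
    intro h3 v hv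
    obtain ⟨u, hu, rfl⟩ := Finset.mem_map.1 hv
    rw [Fin.valEmbedding_apply, hdeg]
    refine degIn_le_three_of_avgDegree hQ S (fun w hw => ?_) u hu
    rw [← hdeg]
    exact h3 w (Finset.mem_map_of_mem Fin.valEmbedding hw)

theorem polyTimeThreeColoring_of_threeSparse {C : Set FinGraph} (hC : ThreeSparse C) :
    PolyTimeThreeColoring C := by
  -- The variable `x₀` bounds all loops, so the decision is kept in `x₆` and copied at the end; the
  -- copy takes the `2` extra steps.
  refine ⟨.seq mainCmd.compile (.assign 0 (.var 6)), mainCmd.bound + 2, fun Q hQ => ?_⟩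
  have hs := holds_inputMemory Q
  obtain ⟨t, hrun, ht⟩ := run_compile mainCmd mainCmd_wellFormed (inputMemory Q)
  rw [hs.size] at ht
  refine ⟨_, _, .seq hrun (.assign 0 (.var 6) _), ?_, ?_⟩
  · simpa [Expr.cost] using ht
  rcases mainCmd_spec hs (natGraph_lt Q) with ⟨hN, h6⟩ | ⟨-, h6, hlt, hne⟩
  · right
    exact ⟨not_colorable_of_not_isNice (hC Q hQ) hN, by simpa [Expr.eval] using h6⟩
  · left
    let f : Q.2.Coloring (Fin 3) := SimpleGraph.Coloring.mk
      (fun v => ⟨(mainCmd.exec (inputMemory Q)).arr 1 v 0, hlt v v.2⟩)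
      (fun {v w} hvw e => hne v w ((natGraph_adj Q v w).2 hvw) (congrArg Fin.val e))
    exact ⟨⟨f⟩, by simpa [Expr.eval] using h6, f, fun v => rfl⟩

end SparseColoring

theorem proposition1 (C : Set SparseColoring.FinGraph) :
    (SparseColoring.PolyTimeThreeColoring C ∨
        ∃ Q ∈ C, SparseColoring.UnlikelySubgraph Q) ∧
      (SparseColoring.ThreeSparse C → SparseColoring.PolyTimeThreeColoring C) ∧
      (¬ SparseColoring.ThreeSparse C → ∃ Q ∈ C, SparseColoring.UnlikelySubgraph Q) := by
  have sparse : SparseColoring.ThreeSparse C → SparseColoring.PolyTimeThreeColoring C :=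
    SparseColoring.polyTimeThreeColoring_of_threeSparse
  have dense : ¬ SparseColoring.ThreeSparse C →
      ∃ Q ∈ C, SparseColoring.UnlikelySubgraph Q := by
    intro h
    simp only [SparseColoring.ThreeSparse, not_forall, not_le] at h
    obtain ⟨Q, hQ, H, hH⟩ := h
    exact ⟨Q, hQ, SparseColoring.unlikelySubgraph_of_avgDegree H hH⟩
  exact ⟨(em (SparseColoring.ThreeSparse C)).imp sparse dense, sparse, dense⟩
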